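/- **Notation.** Let $n\ge 1$. A variable exponent is a measurable function $p:\mathbb R^n\to(0,\infty]$ with $\operatorname{ess\,inf} p>0$; $\mathcal P(\mathbb R^n)$ is the set of all of them. Put $\varphi_p(t)=t^p$ for $p<\infty$, and $\varphi_\infty(t)=0$ for $t\le 1$, $\varphi_\infty(t)=\infty$ for $t>1$, and let $\varrho_{p(\cdot)}(g)=\int_{\mathbb R^n}\varphi_{p(x)}(|g(x)|)\,dx$. For $p,q\in\mathcal P(\mathbb R^n)$ and a sequence $(g_\nu)_{\nu\in\mathbb N_0}$ of measurable functions put $$\varrho_{\ell_{q(\cdot)}(L_{p(\cdot)})}(g_\nu)=\sum_{\nu=0}^\infty\inf\Big\{\lambda>0:\varrho_{p(\cdot)}\big(g_\nu/\lambda^{1/q(\cdot)}\big)\le 1\Big\},\qquad \|g_\nu\,|\,\ell_{q(\cdot)}(L_{p(\cdot)})\|=\inf\big\{\mu>0:\varrho_{\ell_{q(\cdot)}(L_{p(\cdot)})}(g_\nu/\mu)\le 1\big\},$$ with $1/\infty=0$ and $\inf\emptyset=\infty$. For $\alpha\ge 0$ and $\alpha_1\le\alpha_2$ real, a sequence $(w_j)_{j\in\mathbb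 N_0}$ of measurable functions on $\mathbb R^n$ belongs to $\mathcal W^\alpha_{\alpha_1,\alpha_2}$ if there is $C>0$ with $0<w_j(x)\le C\,w_j(y)(1+2^j|x-y|)^\alpha$ for all $j\in\mathbb N_0$, $x,y\in\mathbb R^n$, and $2^{\alpha_1}w_j(x)\le w_{j+1}(x)\le 2^{\alpha_2}w_j(x)$ for all $j\in\mathbb N_0$, $x\in\mathbb R^n$. Given $\psi_0,\psi_1\in\mathcal S(\mathbb R^n)$, put $\psi_j(x)=\psi_1(2^{-j+1}x)$ for $j\ge1$ and $\Psi_j=\widehat{\psi_j}$ for $j\ge 0$, where $\widehat g(\xi)=\int_{\mathbb R^n} e^{-2\pi i x\cdot\xi}g(x)\,dx$. For $f\in\mathcal S'(\mathbb R^n)$, $a>0$ and $k\in\mathbb N_0$ let $$(\Psi_k^*f)_a(x)=\sup_{y\in\mathbb R^n}\frac{|(\Psi_k*f)(y)|}{1+|2^k(y-x)|^a}\in[0,\infty],\qquad x\in\mathbb R^n .$$ Define $\Phi_j$ and $(\Phi_k^*f)_a$ from $\phi_0,\phi_1\in\mathcal S(\mathbb R^n)$ in the same way. **Theorem.** Let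 $(w_j)_{j\in\mathbb N_0}\in\mathcal W^\alpha_{\alpha_1,\alpha_2}$, $p,q\in\mathcal P(\mathbb R^n)$, $a>0$, and let $R\in\mathbb N_0$ with $R>\alpha_2$. Let $\psi_0,\psi_1,\phi_0,\phi_1\in\mathcal S(\mathbb R^n)$ be such that $$D^\beta\psi_1(0)=0\quad\text{for all multi-indices }\beta\text{ with }0\le|\beta|<R,$$ and, for some $\varepsilon>0$, $$|\phi_0(x)|>0\ \text{ if }\ |x|<\varepsilon,\qquad |\phi_1(x)|>0\ \text{ if }\ \varepsilon/2<|x|<2\varepsilon .$$ Then there is a constant $c>0$ such that for every $f\in\mathcal S'(\mathbb R^n)$ $$\big\|(\Psi_k^*f)_a\,w_k\,\big|\,\ell_{q(\cdot)}(L_{p(\cdot)})\big\|\le c\,\big\|(\Phi_k^*f)_a\,w_k\,\big|\,\ell_{q(\cdot)}(L_{p(\cdot)})\big\| .$$ -/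

import Mathlib

open MeasureTheory SchwartzMap FourierTransform
open scoped ENNReal

noncomputable section

namespace Microlocal

/-- A variable exponent function on `ℝⁿ`: a measurable function with values in `(0, ∞]` which is
(essentially) bounded away from zero. -/
structure IsVariableExponent {n : ℕ} (p : EuclideanSpace ℝ (Fin n) → ℝ≥0∞) : Prop where
  measurable : Measurable p
  pos : ∀ x, 0 < p x
  essInf_pos : 0 < essInf p volume

/-- The function `φ_p(t)`: it is `t ^ p` for finite `p`, and for `p = ∞` it is `0` if `t ≤ 1` and
`∞` if `t > 1`. -/
def phi (p t : ℝ≥0∞) : ℝ≥0∞ :=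
  if p = ∞ then (if t ≤ 1 then 0 else ∞) else t ^ p.toReal

/-- The modular of `L_{p(·)}(ℝⁿ)`, on functions with values in `[0, ∞]` (apply it to `|f|`). -/
def modular {n : ℕ} (p g : EuclideanSpace ℝ (Fin n) → ℝ≥0∞) : ℝ≥0∞ :=
  ∫⁻ x, phi (p x) (g x)

/-- The modular of `ℓ_{q(·)}(L_{p(·)})` on sequences of functions with values in `[0, ∞]`.
Here `1 / q(x)` is read as `0` where `q(x) = ∞`, and an infimum over the empty set is `∞`. -/
def mixedModular {n : ℕ} (p q : EuclideanSpace ℝ (Fin n) → ℝ≥0∞)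
    (g : ℕ → EuclideanSpace ℝ (Fin n) → ℝ≥0∞) : ℝ≥0∞ :=
  ∑' ν, sInf {t : ℝ≥0∞ | 0 < t ∧ t < ∞ ∧
    modular p (fun x => g ν x / t ^ ((q x)⁻¹).toReal) ≤ 1}

/-- The (quasi-)norm of `ℓ_{q(·)}(L_{p(·)})`, with value `∞` outside the space. -/
def mixedNorm {n : ℕ} (p q : EuclideanSpace ℝ (Fin n) → ℝ≥0∞)
    (g : ℕ → EuclideanSpace ℝ (Fin n) → ℝ≥0∞) : ℝ≥0∞ :=
  sInf {μ : ℝ≥0∞ | 0 < μ ∧ μ < ∞ ∧ mixedModular p q (fun ν x => g ν x / μ) ≤ 1}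

/-- The class `𝒲^α_{α₁,α₂}` of admissible weight sequences. -/
structure IsAdmissibleWeight {n : ℕ} (α α₁ α₂ : ℝ)
    (w : ℕ → EuclideanSpace ℝ (Fin n) → ℝ) : Prop where
  alpha_nonneg : 0 ≤ α
  alpha_le : α₁ ≤ α₂
  measurable : ∀ j, Measurable (w j)
  growth : ∃ C : ℝ, 0 < C ∧ ∀ j x y,
    0 < w j x ∧ w j x ≤ C * w j y * (1 + 2 ^ j * ‖x - y‖) ^ α
  lower : ∀ j x, (2 : ℝ) ^ α₁ * w j x ≤ w (j + 1) x
  upper : ∀ j x, w (j + 1) x ≤ (2 : ℝ) ^ α₂ * w j x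

/-- The Schwartz function `x ↦ ψ (2 ^ (-j) x)`. -/
def dilate {n : ℕ} (j : ℕ) (ψ : 𝓢(EuclideanSpace ℝ (Fin n), ℂ)) :
    𝓢(EuclideanSpace ℝ (Fin n), ℂ) :=
  compCLMOfContinuousLinearEquiv ℂ (ContinuousLinearEquiv.smulLeft (R₁ := ℝ)
    (Units.mk0 ((2 : ℝ) ^ (-(j : ℤ))) (by positivity))) ψ

theorem dilate_apply {n : ℕ} (j : ℕ) (ψ : 𝓢(EuclideanSpace ℝ (Fin n), ℂ))
    (x : EuclideanSpace ℝ (Fin n)) : dilate j ψ x = ψ ((2 : ℝ) ^ (-(j : ℤ)) • x) := rfl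

/-- The sequence built from two starting functions: `ψ_0` is given, and
`ψ_j(x) = ψ_1(2 ^ (-j + 1) x)` for `j ≥ 1`. -/
def dyadic {n : ℕ} (ψ₀ ψ₁ : 𝓢(EuclideanSpace ℝ (Fin n), ℂ)) :
    ℕ → 𝓢(EuclideanSpace ℝ (Fin n), ℂ)
  | 0 => ψ₀
  | j + 1 => dilate j ψ₁

/-- The Schwartz function `y ↦ Ψ (x - y)`. -/
def reflectTranslate {n : ℕ} (x : EuclideanSpace ℝ (Fin n))
    (Ψ : 𝓢(EuclideanSpace ℝ (Fin n), ℂ)) : 𝓢(EuclideanSpace ℝ (Fin n), ℂ) :=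
  compSubConstCLM ℂ x (compCLMOfContinuousLinearEquiv ℂ (ContinuousLinearEquiv.neg ℝ) Ψ)

theorem reflectTranslate_apply {n : ℕ} (x : EuclideanSpace ℝ (Fin n))
    (Ψ : 𝓢(EuclideanSpace ℝ (Fin n), ℂ)) (y : EuclideanSpace ℝ (Fin n)) :
    reflectTranslate x Ψ y = Ψ (x - y) := by
  change Ψ (-(y - x)) = Ψ (x - y)
  rw [neg_sub]

/-- The convolution `(Ψ * f)(x) = ⟨f, Ψ(x - ·)⟩` of a Schwartz function with a tempered
distribution. -/
def conv {n : ℕ} (Ψ : 𝓢(EuclideanSpace ℝ (Fin n), ℂ))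
    (f : 𝓢'(EuclideanSpace ℝ (Fin n), ℂ)) (x : EuclideanSpace ℝ (Fin n)) : ℂ :=
  f (reflectTranslate x Ψ)

/-- The Peetre maximal operator `(Ψ_k^* f)_a` of a sequence of Schwartz functions, with values in
`[0, ∞]`. -/
def peetre {n : ℕ} (Ψ : ℕ → 𝓢(EuclideanSpace ℝ (Fin n), ℂ))
    (f : 𝓢'(EuclideanSpace ℝ (Fin n), ℂ)) (a : ℝ) (k : ℕ)
    (x : EuclideanSpace ℝ (Fin n)) : ℝ≥0∞ :=
  ⨆ y, ENNReal.ofReal (‖conv (Ψ k) f y‖ / (1 + ‖(2 : ℝ) ^ k • (y - x)‖ ^ a))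

end Microlocal

end

/-!
The proof compares the maximal functions pointwise and then sums up in `ℓ_{q(·)}(L_{p(·)})`.

*Pointwise comparison.* The Tauberian conditions allow division by `φ₀` and `φ₁` near the supports
of a smooth dyadic resolution of unity, which gives Schwartz functions `lam₀`, `lam₁` with
`∑ k, lam_k φ_k = 1` (`exists_resolution`), the partial sums being dilates of one Schwartz function.
Hence `Ψ_ν * f = ∑ k, 𝓕 (ψ_ν lam_k) * Φ_k * f` (`enorm_conv_le_tsum`), and each summand is at most
`(Φ_k^* f)_a` times a weighted `L¹` norm of the kernel `𝓕 (ψ_ν lam_k)`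
(`enorm_conv_pairing_le_peetre`). After rescaling, the kernel is the Fourier transform of
`ψ₁ (t •) lam₁` with `t = 2 ^ (k - ν)`. Its weighted norm is `O(t ^ R)` for `t ≤ 1`, by Taylor's
theorem and the moment conditions, and `O(t ^ (-M))` with any `M` for `t ≥ 1`, since `lam₁` is
supported away from the origin (`exists_lintegral_fourier_dyadic_le`). The weights contribute at
most `2 ^ (α₂ (ν - k))` for `k ≤ ν`, so that the gain is `2 ^ (-(R - α₂) |ν - k|)` in either case
(`exists_peetre_mul_weight_le`).

*Superposition.* That a tempered distribution may be interchanged with the convolution integral is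
`apply_eq_integral_compSubConst`: the distribution is continuous for finitely many Schwartz
seminorms, hence, by the Hahn-Banach theorem, it is the restriction of a functional on a Banach
space of bounded continuous functions, and there the Bochner integral commutes with it.

*Summation.* The inequality `mixedNorm_le_of_le_tsum` says that two-sided geometric averaging is
bounded in `ℓ_{q(·)}(L_{p(·)})`. The modular need not be convex, so sums are first replaced by
suprema at the cost of a part of the geometric factor; the modular of a supremum is at most the sum
of the modulars. The parameters `lam ν` in the definition of the norm are averaged in the same
manner, with a decay so slow that `1 / q`, being essentially bounded, cannot spoil it.
-/

namespace Microlocal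

/-! ### The modulars -/

theorem phi_mono (p : ℝ≥0∞) : Monotone (phi p) := by
  intro s t h
  unfold phi
  by_cases hp : p = ∞
  · by_cases ht : t ≤ 1
    · simp [hp, ht, h.trans ht]
    · simp [hp, ht]
  · simpa [hp] using ENNReal.rpow_le_rpow h ENNReal.toReal_nonneg

theorem phi_iSup_le {p : ℝ≥0∞} (hp : 0 < p) (h : ℕ → ℝ≥0∞) :
    phi p (⨆ k, h k) ≤ ∑' k, phi p (h k) := by
  by_cases hp' : p = ∞
  · subst hp'
    by_cases hall : ∀ k, h k ≤ 1
    · simp [phi, iSup_le hall]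
    · push Not at hall
      obtain ⟨k, hk⟩ := hall
      have h1 : phi ∞ (h k) = ∞ := by simp [phi, not_le.2 hk]
      exact le_top.trans (h1.symm.le.trans (ENNReal.le_tsum k))
  · have hpos : 0 < p.toReal := ENNReal.toReal_pos hp.ne' hp'
    have h1 : phi p (⨆ k, h k) = ⨆ k, phi p (h k) := by
      simp only [phi, hp', if_false]
      exact (ENNReal.orderIsoRpow p.toReal hpos).map_iSup h
    rw [h1]
    exact iSup_le fun k => ENNReal.le_tsum k

theorem phi_mul_le {p b t : ℝ≥0∞} {r : ℝ} (hr : ENNReal.ofReal r ≤ p)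
    (hb0 : b ≠ 0) (hb : b ≤ 1) : phi p (b * t) ≤ b ^ r * phi p t := by
  unfold phi
  by_cases hp : p = ∞
  · have hbr : b ^ r ≠ 0 := by
      simp [ENNReal.rpow_eq_zero_iff, hb0, (hb.trans_lt ENNReal.one_lt_top).ne]
    simp only [hp, if_true]
    by_cases ht : t ≤ 1
    · have : b * t ≤ 1 := mul_le_one' hb ht
      simp [this]
    · simp [ht, ENNReal.mul_top hbr]
  · simp only [hp, if_false]
    rw [ENNReal.mul_rpow_of_nonneg _ _ ENNReal.toReal_nonneg]
    gcongr ?_ * _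
    exact ENNReal.rpow_le_rpow_of_exponent_ge hb ((ENNReal.ofReal_le_iff_le_toReal hp).1 hr)

theorem measurable_phi {n : ℕ} {p h : EuclideanSpace ℝ (Fin n) → ℝ≥0∞} (hp : Measurable p)
    (hh : Measurable h) : Measurable fun x => phi (p x) (h x) := by
  unfold phi
  refine Measurable.ite (hp (measurableSet_singleton _)) ?_ ?_
  · exact Measurable.ite (hh measurableSet_Iic) measurable_const measurable_const
  · exact hh.pow hp.ennreal_toReal

/-- An exponent is almost everywhere bounded below by a positive real number. -/
theorem IsVariableExponent.exists_ofReal_le {n : ℕ} {p : EuclideanSpace ℝ (Fin n) → ℝ≥0∞}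
    (hp : IsVariableExponent p) : ∃ r : ℝ, 0 < r ∧ ∀ᵐ x, ENNReal.ofReal r ≤ p x := by
  obtain ⟨r, -, hr, hr'⟩ := ENNReal.lt_iff_exists_real_btwn.1 hp.essInf_pos
  refine ⟨r, by simpa using hr, ?_⟩
  filter_upwards [ae_essInf_le (f := p) (μ := volume)] with x hx
  exact hr'.le.trans hx

/-! ### Two-sided geometric decay -/

/-- The matrix `2 ^ (-η |ν - k|)` of two-sided geometric decay, with entries in `[0, ∞]`. -/
noncomputable def geomDecay (η : ℝ) (ν k : ℕ) : ℝ≥0∞ :=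
  ENNReal.ofReal ((2 : ℝ) ^ (-η * |(ν : ℝ) - k|))

theorem geomDecay_comm (η : ℝ) (ν k : ℕ) : geomDecay η ν k = geomDecay η k ν := by
  simp only [geomDecay, abs_sub_comm]

theorem geomDecay_ne_zero (η : ℝ) (ν k : ℕ) : geomDecay η ν k ≠ 0 := by
  simp only [geomDecay, ne_eq, ENNReal.ofReal_eq_zero, not_le]
  positivity

theorem geomDecay_ne_top (η : ℝ) (ν k : ℕ) : geomDecay η ν k ≠ ∞ := ENNReal.ofReal_ne_top

theorem geomDecay_le_one {η : ℝ} (hη : 0 ≤ η) (ν k : ℕ) : geomDecay η ν k ≤ 1 := by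
  simp only [geomDecay, ENNReal.ofReal_le_one]
  exact Real.rpow_le_one_of_one_le_of_nonpos (by norm_num)
    (by have := mul_nonneg hη (abs_nonneg ((ν : ℝ) - k)); linarith)

theorem geomDecay_add (η θ : ℝ) (ν k : ℕ) :
    geomDecay (η + θ) ν k = geomDecay η ν k * geomDecay θ ν k := by
  simp only [geomDecay]
  rw [← ENNReal.ofReal_mul (by positivity), ← Real.rpow_add (by norm_num)]
  ring_nf

theorem geomDecay_rpow (η s : ℝ) (ν k : ℕ) :
    geomDecay η ν k ^ s = geomDecay (η * s) ν k := by
  simp only [geomDecay]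
  rw [ENNReal.ofReal_rpow_of_pos (by positivity), ← Real.rpow_mul (by norm_num)]
  ring_nf

theorem exists_tsum_geomDecay_le {η : ℝ} (hη : 0 < η) :
    ∃ B : ℝ≥0∞, B ≠ 0 ∧ B ≠ ∞ ∧ ∀ ν, ∑' k, geomDecay η ν k ≤ B := by
  let F : ℤ → ℝ := fun z => (2 : ℝ) ^ (-η * |(z : ℝ)|)
  have hF : Summable F := by
    have hgeo : Summable fun m : ℕ => ((2 : ℝ) ^ (-η)) ^ m :=
      summable_geometric_of_lt_one (by positivity)
        (Real.rpow_lt_one_of_one_lt_of_neg (by norm_num) (by linarith))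
    refine Summable.of_nat_of_neg ?_ ?_
    · refine hgeo.congr fun m => ?_
      simp only [F, Int.cast_natCast, Nat.abs_cast]
      rw [Real.rpow_mul (by norm_num), Real.rpow_natCast]
    · refine hgeo.congr fun m => ?_
      simp only [F, Int.cast_neg, abs_neg, Int.cast_natCast, Nat.abs_cast]
      rw [Real.rpow_mul (by norm_num), Real.rpow_natCast]
  have hle : ∀ ν : ℕ, ∑' k, geomDecay η ν k ≤ ∑' z, ENNReal.ofReal (F z) := by
    intro ν
    have hinj : Function.Injective fun k : ℕ => (ν : ℤ) - k := by
      intro k l h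
      simpa using h
    refine le_trans (le_of_eq ?_) (ENNReal.tsum_comp_le_tsum_of_injective hinj
      (fun z => ENNReal.ofReal (F z)))
    refine tsum_congr fun k => ?_
    simp [F, geomDecay]
  refine ⟨∑' z, ENNReal.ofReal (F z), ?_, hF.tsum_ofReal_ne_top, hle⟩
  have h1 : (1 : ℝ≥0∞) ≤ ∑' z, ENNReal.ofReal (F z) := by
    refine le_trans ?_ (ENNReal.le_tsum 0)
    simp [F]
  exact (lt_of_lt_of_le zero_lt_one h1).ne'

/-! ### A discrete Hardy inequality in `ℓ_{q(·)}(L_{p(·)})` -/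

/-- If each modular of `h k` is at most one, then so is the modular of `⨆ k, b k * h k`, provided
the `r`-th powers of the small factors `b k` sum up to at most one. Passing from sums to suprema
is what replaces a triangle inequality for the modular. -/
theorem modular_iSup_mul_le {n : ℕ} {p : EuclideanSpace ℝ (Fin n) → ℝ≥0∞}
    (hp : IsVariableExponent p) {r : ℝ} (hr : ∀ᵐ x, ENNReal.ofReal r ≤ p x)
    {h : ℕ → EuclideanSpace ℝ (Fin n) → ℝ≥0∞} (hh : ∀ k, Measurable (h k))
    (hmod : ∀ k, modular p (h k) ≤ 1) {b : ℕ → ℝ≥0∞} (hb0 : ∀ k, b k ≠ 0) (hb1 : ∀ k, b k ≤ 1)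
    (hb : ∑' k, b k ^ r ≤ 1) : modular p (fun x => ⨆ k, b k * h k x) ≤ 1 := by
  calc modular p (fun x => ⨆ k, b k * h k x)
      ≤ ∫⁻ x, ∑' k, b k ^ r * phi (p x) (h k x) := by
        refine lintegral_mono_ae ?_
        filter_upwards [hr] with x hx
        refine (phi_iSup_le (hp.pos x) _).trans ?_
        exact ENNReal.tsum_le_tsum fun k => phi_mul_le hx (hb0 k) (hb1 k)
    _ = ∑' k, b k ^ r * modular p (h k) := by
        rw [lintegral_tsum fun k => ((measurable_phi hp.measurable (hh k)).const_mul _).aemeasurable]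
        exact tsum_congr fun k => lintegral_const_mul _ (measurable_phi hp.measurable (hh k))
    _ ≤ ∑' k, b k ^ r := ENNReal.tsum_le_tsum fun k => mul_le_of_le_one_right' (hmod k)
    _ ≤ 1 := hb

theorem modular_mono {n : ℕ} (p : EuclideanSpace ℝ (Fin n) → ℝ≥0∞)
    {g h : EuclideanSpace ℝ (Fin n) → ℝ≥0∞} (hgh : ∀ᵐ x, g x ≤ h x) :
    modular p g ≤ modular p h := by
  refine lintegral_mono_ae ?_
  filter_upwards [hgh] with x hx
  exact phi_mono _ hx

theorem modular_div_rpow_anti {n : ℕ} (p q g : EuclideanSpace ℝ (Fin n) → ℝ≥0∞) {s t : ℝ≥0∞}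
    (hst : s ≤ t) : modular p (fun x => g x / t ^ ((q x)⁻¹).toReal) ≤
      modular p (fun x => g x / s ^ ((q x)⁻¹).toReal) :=
  modular_mono p <| .of_forall fun _ =>
    ENNReal.div_le_div_left (ENNReal.rpow_le_rpow hst ENNReal.toReal_nonneg) _

/-- A sequence of modular at most one has admissible parameters `lam ν` in the infima defining its
modular, with sum at most two. -/
theorem exists_admissible_of_mixedModular_le_one {n : ℕ}
    {p q : EuclideanSpace ℝ (Fin n) → ℝ≥0∞} {g : ℕ → EuclideanSpace ℝ (Fin n) → ℝ≥0∞}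
    (hg : mixedModular p q g ≤ 1) :
    ∃ lam : ℕ → ℝ≥0∞, (∀ ν, lam ν ≠ 0) ∧ (∀ ν, lam ν ≠ ∞) ∧ ∑' ν, lam ν ≤ 2 ∧
      ∀ ν, modular p (fun x => g ν x / lam ν ^ ((q x)⁻¹).toReal) ≤ 1 := by
  obtain ⟨ε, hε, hsum⟩ := ENNReal.exists_pos_sum_of_countable' (one_ne_zero (α := ℝ≥0∞)) ℕ
  let S : ℕ → ℝ≥0∞ := fun ν => sInf {t : ℝ≥0∞ | 0 < t ∧ t < ∞ ∧
    modular p (fun x => g ν x / t ^ ((q x)⁻¹).toReal) ≤ 1}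
  have hS : ∑' ν, S ν ≤ 1 := hg
  have hSfin : ∀ ν, S ν ≠ ∞ := fun ν =>
    (((ENNReal.le_tsum ν).trans hS).trans_lt ENNReal.one_lt_top).ne
  have hεfin : ∀ ν, ε ν ≠ ∞ := fun ν =>
    ((ENNReal.le_tsum ν).trans_lt (hsum.trans ENNReal.one_lt_top)).ne
  refine ⟨fun ν => S ν + ε ν, fun ν => ?_, fun ν => ?_, ?_, fun ν => ?_⟩
  · simp [(hε ν).ne']
  · simp [hSfin ν, hεfin ν]
  · rw [ENNReal.tsum_add]
    exact (add_le_add hS hsum.le).trans_eq one_add_one_eq_two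
  · obtain ⟨t, ht, hlt⟩ := sInf_lt_iff.1
      (ENNReal.lt_add_right (hSfin ν) (hε ν).ne' : S ν < S ν + ε ν)
    exact (modular_div_rpow_anti p q (g ν) hlt.le).trans ht.2.2

/-- A discrete Hardy inequality: averaging with two-sided geometric decay is bounded in
`ℓ_{q(·)}(L_{p(·)})`. No triangle inequality is available, as `p` and `q` may take values below
one; the decay `δ` is spent in four equal parts instead. Two of them compare `lam k` with the
averaged parameters of `G`, one turns the sum over `k` into a supremum, and the last makes the
modular of the supremum at most one. -/
theorem mixedNorm_le_of_le_tsum {n : ℕ} {p q : EuclideanSpace ℝ (Fin n) → ℝ≥0∞}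
    (hp : IsVariableExponent p) (hq : IsVariableExponent q) {δ : ℝ} (hδ : 0 < δ)
    {C : ℝ≥0∞} (hC0 : C ≠ 0) (hC : C ≠ ∞) :
    ∃ c : ℝ≥0∞, c ≠ 0 ∧ c ≠ ∞ ∧ ∀ g G : ℕ → EuclideanSpace ℝ (Fin n) → ℝ≥0∞,
      (∀ k, Measurable (g k)) →
      (∀ ν x, G ν x ≤ C * ∑' k, geomDecay δ ν k * g k x) →
      mixedNorm p q G ≤ c * mixedNorm p q g := by
  obtain ⟨r, hr0, hr⟩ := hp.exists_ofReal_le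
  obtain ⟨r', hr'0, hr'⟩ := hq.exists_ofReal_le
  set Q : ℝ := r'⁻¹ with hQ
  have hQ0 : 0 < Q := inv_pos.2 hr'0
  -- `Q` is an essential upper bound of `1 / q`, so that `η`-decay raised to the power `1 / q` is
  -- bounded below by `(δ / 2)`-decay
  set η : ℝ := δ / (2 * Q) with hη
  have hη0 : 0 < η := by positivity
  have hηQ : η * Q = δ / 2 := by rw [hη]; field_simp
  obtain ⟨B₁, hB₁0, hB₁, hB₁le⟩ := exists_tsum_geomDecay_le hη0
  obtain ⟨B₂, hB₂0, hB₂, hB₂le⟩ := exists_tsum_geomDecay_le (show 0 < δ / 4 by positivity)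
  obtain ⟨B₃, hB₃0, hB₃, hB₃le⟩ := exists_tsum_geomDecay_le (show 0 < δ / 4 * r by positivity)
  -- `A` makes the averages `Lam` of `lam` sum up to at most one, `b` does the same for the `r`-th
  -- powers of the factors inside the supremum
  set A : ℝ≥0∞ := min 1 (2 * B₁)⁻¹ with hA
  have hA0 : A ≠ 0 := by
    simp [hA, ENNReal.mul_eq_top, hB₁]
  have hA1 : A ≤ 1 := min_le_left _ _
  have hAtop : A ≠ ∞ := (hA1.trans_lt ENNReal.one_lt_top).ne
  set b : ℝ≥0∞ := min 1 (B₃⁻¹ ^ (r⁻¹)) with hb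
  have hb1 : b ≤ 1 := min_le_left _ _
  have hb0 : b ≠ 0 := by
    have : B₃⁻¹ ^ (r⁻¹) ≠ 0 := by
      simp [ENNReal.rpow_eq_zero_iff, hB₃, hB₃0]
    rw [hb, ← pos_iff_ne_zero]
    exact lt_min one_pos (pos_iff_ne_zero.2 this)
  have hbtop : b ≠ ∞ := (hb1.trans_lt ENNReal.one_lt_top).ne
  have hbr : b ^ r ≤ B₃⁻¹ := by
    calc b ^ r ≤ (B₃⁻¹ ^ (r⁻¹)) ^ r := ENNReal.rpow_le_rpow (min_le_right _ _) hr0.le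
      _ = B₃⁻¹ := ENNReal.rpow_inv_rpow hr0.ne' _
  have hAQ0 : A ^ Q ≠ 0 := by simp [ENNReal.rpow_eq_zero_iff, hA0, hAtop]
  have hAQtop : A ^ Q ≠ ∞ := ENNReal.rpow_ne_top_of_nonneg hQ0.le hAtop
  set c : ℝ≥0∞ := C * (A ^ Q)⁻¹ * B₂ * b⁻¹ with hc
  have hc0 : c ≠ 0 := by
    simp [hc, hC0, hAQtop, hB₂0, hbtop]
  have hctop : c ≠ ∞ := by
    simp [hc, ENNReal.mul_eq_top, hC, hAQ0, hB₂, hb0]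
  refine ⟨c, hc0, hctop, fun g G hg hG => ?_⟩
  -- it suffices to multiply an admissible `μ` by `c`
  suffices H : ∀ μ : ℝ≥0∞, μ ≠ 0 → μ ≠ ∞ → mixedModular p q (fun ν x => g ν x / μ) ≤ 1 →
      mixedModular p q (fun ν x => G ν x / (c * μ)) ≤ 1 by
    rw [mul_comm, ← ENNReal.div_le_iff hc0 hctop]
    refine le_sInf ?_
    rintro μ ⟨hμ0, hμ, hmod⟩
    rw [ENNReal.div_le_iff hc0 hctop]
    refine sInf_le ⟨?_, ?_, ?_⟩
    · exact pos_iff_ne_zero.2 (mul_ne_zero hμ0.ne' hc0)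
    · exact ENNReal.mul_lt_top hμ hctop.lt_top
    · rw [mul_comm]
      exact H μ hμ0.ne' hμ.ne hmod
  intro μ hμ0 hμ hmod
  obtain ⟨lam, hlam0, hlam, hlamsum, hlammod⟩ := exists_admissible_of_mixedModular_le_one hmod
  -- admissible parameters for `G`
  set Lam : ℕ → ℝ≥0∞ := fun ν => A * ∑' k, geomDecay η ν k * lam k with hLam
  have hLamle : ∀ ν k, A * geomDecay η ν k * lam k ≤ Lam ν := fun ν k => by
    simp only [hLam, mul_assoc]
    gcongr
    exact ENNReal.le_tsum (f := fun k => geomDecay η ν k * lam k) k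
  have hLamsum : ∑' ν, Lam ν ≤ 1 := by
    calc ∑' ν, Lam ν = A * ∑' k, ∑' ν, geomDecay η ν k * lam k := by
          rw [hLam, ENNReal.tsum_mul_left, ENNReal.tsum_comm]
      _ ≤ A * ∑' k, B₁ * lam k := by
          gcongr with k
          rw [ENNReal.tsum_mul_right]
          gcongr
          simpa only [geomDecay_comm η _ k] using hB₁le k
      _ ≤ (2 * B₁)⁻¹ * (B₁ * 2) := by
          rw [ENNReal.tsum_mul_left]
          gcongr
          exact min_le_right _ _
      _ = 1 := by
          rw [mul_comm B₁]
          exact ENNReal.inv_mul_cancel (by simp [hB₁0]) (by simp [ENNReal.mul_eq_top, hB₁])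
  have hLamtop : ∀ ν, Lam ν < ∞ := fun ν =>
    ((ENNReal.le_tsum ν).trans hLamsum).trans_lt ENNReal.one_lt_top
  have hLam0 : ∀ ν, 0 < Lam ν := fun ν =>
    (pos_iff_ne_zero.2 (mul_ne_zero (mul_ne_zero hA0 (geomDecay_ne_zero _ _ _))
      (hlam0 ν))).trans_le (hLamle ν ν)
  refine le_trans (ENNReal.tsum_le_tsum fun ν => sInf_le ⟨hLam0 ν, hLamtop ν, ?_⟩) hLamsum
  set h : ℕ → EuclideanSpace ℝ (Fin n) → ℝ≥0∞ :=
    fun k x => g k x / μ / lam k ^ ((q x)⁻¹).toReal with hh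
  have hhmeas : ∀ k, Measurable (h k) := fun k =>
    ((hg k).div_const μ).div (measurable_const.pow hq.measurable.inv.ennreal_toReal)
  refine le_trans (modular_mono p (h := fun x => ⨆ k, b * geomDecay (δ / 4) ν k * h k x) ?_)
    (modular_iSup_mul_le hp hr hhmeas hlammod
      (fun k => mul_ne_zero hb0 (geomDecay_ne_zero _ _ _))
      (fun k => mul_le_one' hb1 (geomDecay_le_one (by positivity) _ _)) ?_)
  · filter_upwards [hr'] with x hx
    set s : ℝ := ((q x)⁻¹).toReal with hs
    have hs0 : 0 ≤ s := ENNReal.toReal_nonneg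
    have hsQ : s ≤ Q := by
      rw [hs, hQ, ← ENNReal.toReal_ofReal (inv_nonneg.2 hr'0.le)]
      refine ENNReal.toReal_mono ENNReal.ofReal_ne_top ?_
      rw [ENNReal.ofReal_inv_of_pos hr'0]
      exact ENNReal.inv_le_inv.2 hx
    have hpow : ∀ k, A ^ Q * geomDecay (δ / 2) ν k * lam k ^ s ≤ Lam ν ^ s := fun k => by
      calc A ^ Q * geomDecay (δ / 2) ν k * lam k ^ s
          = (A * geomDecay η ν k) ^ Q * lam k ^ s := by
            rw [ENNReal.mul_rpow_of_nonneg _ _ hQ0.le, geomDecay_rpow, hηQ]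
        _ ≤ (A * geomDecay η ν k) ^ s * lam k ^ s := by
            gcongr ?_ * _
            exact ENNReal.rpow_le_rpow_of_exponent_ge
              (mul_le_one' hA1 (geomDecay_le_one hη0.le _ _)) hsQ
        _ = (A * geomDecay η ν k * lam k) ^ s := (ENNReal.mul_rpow_of_nonneg _ _ hs0).symm
        _ ≤ Lam ν ^ s := ENNReal.rpow_le_rpow (hLamle ν k) hs0
    have hterm : ∀ k, geomDecay δ ν k * (g k x / μ) / Lam ν ^ s ≤
        (A ^ Q)⁻¹ * (geomDecay (δ / 2) ν k * h k x) := fun k => by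
      have hd0 := geomDecay_ne_zero (δ / 2) ν k
      have hdt := geomDecay_ne_top (δ / 2) ν k
      calc geomDecay δ ν k * (g k x / μ) / Lam ν ^ s
          ≤ geomDecay δ ν k * (g k x / μ) / (A ^ Q * geomDecay (δ / 2) ν k * lam k ^ s) :=
            ENNReal.div_le_div_left (hpow k) _
        _ = (A ^ Q)⁻¹ * (geomDecay (δ / 2) ν k * h k x) := by
            have hsplit : geomDecay δ ν k = geomDecay (δ / 2) ν k * geomDecay (δ / 2) ν k := by
              rw [← geomDecay_add]; ring_nf
            simp only [hh]
            rw [hsplit, div_eq_mul_inv, div_eq_mul_inv (g k x / μ),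
              ENNReal.mul_inv (.inr (ENNReal.rpow_ne_top_of_nonneg hs0 (hlam k)))
                (.inl (ENNReal.mul_ne_top hAQtop hdt)),
              ENNReal.mul_inv (.inl hAQ0) (.inl hAQtop)]
            calc _ = (A ^ Q)⁻¹ * (geomDecay (δ / 2) ν k * (g k x / μ * (lam k ^ s)⁻¹)) *
                  (geomDecay (δ / 2) ν k * (geomDecay (δ / 2) ν k)⁻¹) := by ring
              _ = _ := by rw [ENNReal.mul_inv_cancel hd0 hdt, mul_one]
    have hterm' : ∀ k, geomDecay (δ / 2) ν k * h k x ≤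
        b⁻¹ * geomDecay (δ / 4) ν k * ⨆ k, b * geomDecay (δ / 4) ν k * h k x := fun k => by
      have hsplit : geomDecay (δ / 2) ν k = geomDecay (δ / 4) ν k * geomDecay (δ / 4) ν k := by
        rw [← geomDecay_add]; ring_nf
      calc geomDecay (δ / 2) ν k * h k x
          = (b⁻¹ * b) * (geomDecay (δ / 4) ν k * geomDecay (δ / 4) ν k) * h k x := by
            rw [ENNReal.inv_mul_cancel hb0 hbtop, one_mul, hsplit]
        _ = b⁻¹ * geomDecay (δ / 4) ν k * (b * geomDecay (δ / 4) ν k * h k x) := by ring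
        _ ≤ _ := by
          gcongr
          exact le_iSup (fun k => b * geomDecay (δ / 4) ν k * h k x) k
    set M : ℝ≥0∞ := ⨆ k, b * geomDecay (δ / 4) ν k * h k x with hM
    calc G ν x / (c * μ) / Lam ν ^ s
        ≤ C * (∑' k, geomDecay δ ν k * g k x) / (c * μ) / Lam ν ^ s := by
          gcongr
          exact hG ν x
      _ = C * c⁻¹ * ∑' k, geomDecay δ ν k * (g k x / μ) / Lam ν ^ s := by
          simp only [div_eq_mul_inv]
          rw [ENNReal.mul_inv (.inl hc0) (.inl hctop)]
          simp_rw [← mul_assoc]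
          rw [ENNReal.tsum_mul_right, ENNReal.tsum_mul_right]
          ring
      _ ≤ C * c⁻¹ * ∑' k, (A ^ Q)⁻¹ * (b⁻¹ * geomDecay (δ / 4) ν k * M) := by
          gcongr with k
          exact (hterm k).trans (mul_le_mul' le_rfl (hterm' k))
      _ = C * c⁻¹ * ((A ^ Q)⁻¹ * (b⁻¹ * (∑' k, geomDecay (δ / 4) ν k) * M)) := by
          rw [ENNReal.tsum_mul_left, ENNReal.tsum_mul_right, ENNReal.tsum_mul_left]
      _ ≤ C * c⁻¹ * ((A ^ Q)⁻¹ * (b⁻¹ * B₂ * M)) := by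
          gcongr
          exact hB₂le ν
      _ = c * c⁻¹ * M := by rw [hc]; ring
      _ = M := by rw [ENNReal.mul_inv_cancel hc0 hctop, one_mul]
  · calc ∑' k, (b * geomDecay (δ / 4) ν k) ^ r
        = b ^ r * ∑' k, geomDecay (δ / 4 * r) ν k := by
          simp_rw [ENNReal.mul_rpow_of_nonneg _ _ hr0.le, geomDecay_rpow]
          rw [ENNReal.tsum_mul_left]
      _ ≤ B₃⁻¹ * B₃ := by
          gcongr
          exact hB₃le ν
      _ = 1 := ENNReal.inv_mul_cancel hB₃0 hB₃

/-! ### Tempered distributions and Schwartz-valued integrals -/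

section SchwartzIntegral

open scoped BoundedContinuousFunction

variable {V : Type*} [NormedAddCommGroup V] [NormedSpace ℝ V]

variable (V) in
/-- The Banach space of bounded continuous functions with values in the `l`-linear forms. The type
synonym hides the function type, which keeps the search for norm instances short. -/
def BoundedForms (l : ℕ) : Type _ := V →ᵇ V [×l]→L[ℝ] ℂ

noncomputable instance (l : ℕ) : NormedAddCommGroup (BoundedForms V l) :=
  inferInstanceAs (NormedAddCommGroup (V →ᵇ V [×l]→L[ℝ] ℂ))

noncomputable instance (l : ℕ) : NormedSpace ℂ (BoundedForms V l) :=
  inferInstanceAs (NormedSpace ℂ (V →ᵇ V [×l]→L[ℝ] ℂ))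

instance (l : ℕ) : CompleteSpace (BoundedForms V l) :=
  inferInstanceAs (CompleteSpace (V →ᵇ V [×l]→L[ℝ] ℂ))

/-- Evaluation of a bounded continuous form-valued function at a point. -/
noncomputable def BoundedForms.evalCLM (l : ℕ) (x : V) :
    BoundedForms V l →L[ℝ] V [×l]→L[ℝ] ℂ :=
  LinearMap.mkContinuous
    { toFun := fun g => DFunLike.coe (F := V →ᵇ V [×l]→L[ℝ] ℂ) g x
      map_add' := fun _ _ => rfl
      map_smul' := fun _ _ => rfl } 1 fun g => by
    rw [one_mul]
    exact BoundedContinuousFunction.norm_coe_le_norm (α := V) (β := V [×l]→L[ℝ] ℂ) g x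

theorem BoundedForms.ext {l : ℕ} {f g : BoundedForms V l}
    (h : ∀ x, evalCLM l x f = evalCLM l x g) : f = g :=
  BoundedContinuousFunction.ext h

theorem BoundedForms.norm_le {l : ℕ} (f : BoundedForms V l) {C : ℝ} (hC : 0 ≤ C) :
    ‖f‖ ≤ C ↔ ∀ x, ‖evalCLM l x f‖ ≤ C :=
  BoundedContinuousFunction.norm_le (α := V) (β := V [×l]→L[ℝ] ℂ) (f := f) hC

/-- The map `g ↦ ‖x‖ ^ k D^l g` from the Schwartz space to bounded continuous functions; its
norm is the Schwartz seminorm of order `(k, l)`. -/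
noncomputable def weightedDerivCLM (k l : ℕ) : 𝓢(V, ℂ) →L[ℂ] BoundedForms V l :=
  mkCLMtoNormedSpace (σ := RingHom.id ℂ) (D := V) (E := ℂ) (G := BoundedForms V l)
    (fun g => (BoundedContinuousFunction.ofNormedAddCommGroup
      (fun x => ‖x‖ ^ k • iteratedFDeriv ℝ l g x)
      ((continuous_norm.pow k).smul ((g.smooth ⊤).continuous_iteratedFDeriv (mod_cast le_top)))
      (SchwartzMap.seminorm ℂ k l g) fun x => by
        rw [norm_smul, norm_pow, norm_norm]
        exact le_seminorm ℂ k l g x : V →ᵇ V [×l]→L[ℝ] ℂ))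
    (fun f g => by
      refine BoundedForms.ext fun x => ?_
      change ‖x‖ ^ k • iteratedFDeriv ℝ l ⇑(f + g) x =
        ‖x‖ ^ k • iteratedFDeriv ℝ l f x + ‖x‖ ^ k • iteratedFDeriv ℝ l g x
      rw [FunLike.coe_add, iteratedFDeriv_add_apply (f.contDiffAt l) (g.contDiffAt l), smul_add])
    (fun c g => by
      refine BoundedForms.ext fun x => ?_
      change ‖x‖ ^ k • iteratedFDeriv ℝ l ⇑(c • g) x = c • ‖x‖ ^ k • iteratedFDeriv ℝ l g x
      rw [FunLike.coe_smul, iteratedFDeriv_const_smul_apply (g.contDiffAt l), smul_comm])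
    ⟨{(k, l)}, 1, zero_le_one, fun g => by
      rw [one_mul, Finset.sup_singleton]
      exact BoundedContinuousFunction.norm_ofNormedAddCommGroup_le _ (apply_nonneg _ _) _⟩

theorem evalCLM_weightedDerivCLM (k l : ℕ) (g : 𝓢(V, ℂ)) (x : V) :
    BoundedForms.evalCLM l x (weightedDerivCLM k l g) = ‖x‖ ^ k • iteratedFDeriv ℝ l g x := rfl

theorem norm_weightedDerivCLM (k l : ℕ) (g : 𝓢(V, ℂ)) :
    ‖weightedDerivCLM k l g‖ = SchwartzMap.seminorm ℂ k l g := by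
  have h (x : V) : ‖BoundedForms.evalCLM l x (weightedDerivCLM k l g)‖ =
      ‖x‖ ^ k * ‖iteratedFDeriv ℝ l g x‖ := by
    rw [evalCLM_weightedDerivCLM, norm_smul, norm_pow, norm_norm]
  refine le_antisymm ?_ ?_
  · exact (BoundedForms.norm_le _ (apply_nonneg _ _)).2 fun x =>
      (h x).trans_le (le_seminorm ℂ k l g x)
  · exact seminorm_le_bound ℂ k l g (norm_nonneg _) fun x =>
      (h x).symm.trans_le ((BoundedForms.norm_le _ (norm_nonneg _)).1 le_rfl x)

/-- A linear functional dominated by the norm of the values of a linear map into a normed space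
factors through that map, by the Hahn-Banach theorem. -/
theorem exists_clm_comp_eq {S X : Type*} [AddCommGroup S] [Module ℂ S] [NormedAddCommGroup X]
    [NormedSpace ℂ X] (ι : S →ₗ[ℂ] X) (f : S →ₗ[ℂ] ℂ) {C : NNReal}
    (hf : ∀ g, ‖f g‖ ≤ C * ‖ι g‖) : ∃ F : X →L[ℂ] ℂ, ∀ g, F (ι g) = f g := by
  have hker : f ∈ LinearMap.range ι.dualMap := by
    rw [LinearMap.range_dualMap_eq_dualAnnihilator_ker, Submodule.mem_dualAnnihilator]
    intro g hg
    have := hf g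
    rw [LinearMap.mem_ker.1 hg, norm_zero, mul_zero] at this
    simpa using this
  obtain ⟨F₀, hF₀⟩ := hker
  have hF₀' : ∀ g, F₀ (ι g) = f g := fun g => LinearMap.congr_fun hF₀ g
  obtain ⟨F, hF, -⟩ := Module.Dual.exists_continuous_extension_of_le_seminorm
    (LinearMap.range ι) (F₀.domRestrict _) (p := C • normSeminorm ℂ X)
    (continuous_norm.const_smul C) (by
      rintro ⟨-, g, rfl⟩
      have := hf g
      rw [← hF₀'] at this
      exact this)
  exact ⟨F, fun g => (hF ⟨ι g, g, rfl⟩).trans (hF₀' g)⟩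

/-- A continuous functional on the Schwartz space factors through finitely many of the maps
`weightedDerivCLM`, by the Hahn-Banach theorem. -/
theorem exists_comp_weightedDerivCLM (f : 𝓢(V, ℂ) →L[ℂ] ℂ) :
    ∃ (s : Finset (ℕ × ℕ)) (F : ((i : s) → BoundedForms V i.1.2) →L[ℂ] ℂ),
      ∀ g, f g = F fun i => weightedDerivCLM i.1.1 i.1.2 g := by
  obtain ⟨s, C, -, hC⟩ := Seminorm.bound_of_continuous (schwartz_withSeminorms ℂ V ℂ)
    ((normSeminorm ℂ ℂ).comp f.toLinearMap) (by
      change Continuous fun g => ‖f g‖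
      fun_prop)
  let ι : 𝓢(V, ℂ) →ₗ[ℂ] (i : s) → BoundedForms V i.1.2 :=
    LinearMap.pi fun i => (weightedDerivCLM i.1.1 i.1.2).toLinearMap
  have hbound : ∀ g, ‖f g‖ ≤ C * ‖ι g‖ := fun g => by
    refine (hC g).trans ?_
    change C * (s.sup (schwartzSeminormFamily ℂ V ℂ)) g ≤ _
    gcongr
    refine Seminorm.finset_sup_apply_le (norm_nonneg _) fun i hi => ?_
    change SchwartzMap.seminorm ℂ i.1 i.2 g ≤ _
    rw [← norm_weightedDerivCLM]
    exact norm_le_pi_norm (ι g) ⟨i, hi⟩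
  obtain ⟨F, hF⟩ := @exists_clm_comp_eq _ _ _ _ _ _ ι f.toLinearMap C hbound
  exact ⟨s, F, fun g => (hF g).symm⟩

/-- Translates of a Schwartz function, in every seminorm, grow at most polynomially. -/
theorem exists_seminorm_compSubConst_le (g : 𝓢(V, ℂ)) (k l : ℕ) :
    ∃ C : ℝ, 0 ≤ C ∧ ∀ a x : V, ‖x‖ ^ k * ‖iteratedFDeriv ℝ l g (x - a)‖ ≤ C * (1 + ‖a‖) ^ k := by
  refine ⟨2 ^ k * (Finset.Iic (k, l)).sup (fun m => SchwartzMap.seminorm ℂ m.1 m.2) g,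
    by positivity, fun a x => ?_⟩
  have h1 := one_add_le_sup_seminorm_apply (𝕜 := ℂ) (m := (k, l)) le_rfl le_rfl g (x - a)
  have h2 : ‖x‖ ≤ (1 + ‖x - a‖) * (1 + ‖a‖) := by
    have := norm_add_le (x - a) a
    rw [sub_add_cancel] at this
    nlinarith [norm_nonneg (x - a), norm_nonneg a]
  calc ‖x‖ ^ k * ‖iteratedFDeriv ℝ l g (x - a)‖
      ≤ ((1 + ‖x - a‖) * (1 + ‖a‖)) ^ k * ‖iteratedFDeriv ℝ l g (x - a)‖ := by gcongr
    _ = ((1 + ‖x - a‖) ^ k * ‖iteratedFDeriv ℝ l g (x - a)‖) * (1 + ‖a‖) ^ k := by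
      rw [mul_pow]; ring
    _ ≤ _ := by gcongr

theorem iteratedFDeriv_compSubConstCLM (g : 𝓢(V, ℂ)) (l : ℕ) (a x : V) :
    iteratedFDeriv ℝ l (compSubConstCLM ℂ a g) x = iteratedFDeriv ℝ l g (x - a) :=
  iteratedFDeriv_comp_sub l a x

/-- Translation is continuous in the Schwartz space. -/
theorem continuous_compSubConstCLM (g : 𝓢(V, ℂ)) :
    Continuous fun a : V => compSubConstCLM ℂ a g := by
  rw [continuous_iff_continuousAt]
  intro a
  rw [ContinuousAt, (schwartz_withSeminorms ℂ V ℂ).tendsto_nhds _ _]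
  rintro ⟨k, l⟩ ε hε
  obtain ⟨C, hC0, hC⟩ := exists_seminorm_compSubConst_le g k (l + 1)
  set B : ℝ := C * (1 + (‖a‖ + 1)) ^ k with hB
  have hB0 : 0 ≤ B := by positivity
  filter_upwards [Metric.ball_mem_nhds a (show 0 < min 1 (ε / (B + 1)) by positivity)] with b hb
  have hb1 : ‖b - a‖ < 1 := (mem_ball_iff_norm.1 hb).trans_le (min_le_left _ _)
  have hb2 : ‖b - a‖ < ε / (B + 1) := (mem_ball_iff_norm.1 hb).trans_le (min_le_right _ _)
  have key : SchwartzMap.seminorm ℂ k l (compSubConstCLM ℂ b g - compSubConstCLM ℂ a g) ≤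
      B * ‖b - a‖ := by
    refine seminorm_le_bound ℂ k l _ (by positivity) fun x => ?_
    have hsub : iteratedFDeriv ℝ l (compSubConstCLM ℂ b g - compSubConstCLM ℂ a g) x =
        iteratedFDeriv ℝ l g (x - b) - iteratedFDeriv ℝ l g (x - a) := by
      rw [FunLike.coe_sub, iteratedFDeriv_sub_apply (SchwartzMap.contDiffAt _ l)
        (SchwartzMap.contDiffAt _ l), iteratedFDeriv_compSubConstCLM,
        iteratedFDeriv_compSubConstCLM]
    rw [hsub]
    have hdiff : Differentiable ℝ (iteratedFDeriv ℝ l g) :=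
      (g.smooth ⊤).differentiable_iteratedFDeriv (mod_cast ENat.natCast_lt_top l)
    have hmvt := Convex.norm_image_sub_le_of_norm_fderiv_le (𝕜 := ℝ)
      (f := fun y => ‖x‖ ^ k • iteratedFDeriv ℝ l g y) (C := B) (s := Metric.ball (x - a) 1)
      (x := x - a) (y := x - b) (fun y _ => (hdiff y).const_smul (‖x‖ ^ k)) (fun y hy => ?_)
      (convex_ball _ _) (Metric.mem_ball_self one_pos) (by
        rwa [mem_ball_iff_norm, sub_sub_sub_cancel_left, norm_sub_rev])
    · rw [← smul_sub, norm_smul, norm_pow, norm_norm] at hmvt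
      refine hmvt.trans_eq ?_
      rw [sub_sub_sub_cancel_left, norm_sub_rev]
    · rw [fderiv_fun_const_smul (hdiff y), norm_smul, norm_pow, norm_norm, norm_fderiv_iteratedFDeriv]
      have h1 := hC (x - y) x
      rw [sub_sub_cancel] at h1
      refine h1.trans ?_
      rw [hB]
      gcongr
      have h2 : x - y = a - (y - (x - a)) := by abel
      rw [h2]
      have := (norm_sub_le a (y - (x - a)))
      have h3 : ‖y - (x - a)‖ < 1 := mem_ball_iff_norm.1 hy
      linarith
  calc SchwartzMap.seminorm ℂ k l (compSubConstCLM ℂ b g - compSubConstCLM ℂ a g)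
      ≤ B * ‖b - a‖ := key
    _ ≤ (B + 1) * ‖b - a‖ := by gcongr; linarith
    _ < (B + 1) * (ε / (B + 1)) := by gcongr
    _ = ε := by field_simp

variable [FiniteDimensional ℝ V] [MeasurableSpace V] [BorelSpace V]
  {μ : Measure V} [μ.HasTemperateGrowth]

theorem integrable_smul_iteratedFDeriv_sub (K g : 𝓢(V, ℂ)) {T : V → V} (hT : Continuous T)
    (l : ℕ) (x : V) :
    Integrable (fun z => K z • iteratedFDeriv ℝ l g (x - T z)) μ := by
  refine Integrable.mono' (g := fun z => ‖K z‖ * SchwartzMap.seminorm ℂ 0 l g)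
    (K.integrable.norm.mul_const _) ?_ (.of_forall fun z => ?_)
  · have : Continuous (iteratedFDeriv ℝ l g) :=
      (g.smooth ⊤).continuous_iteratedFDeriv (mod_cast le_top)
    exact (K.continuous.smul (this.comp (continuous_const.sub hT))).aestronglyMeasurable
  · rw [norm_smul]
    gcongr
    exact norm_iteratedFDeriv_le_seminorm ℂ g l _

open LineDeriv

/-- Differentiation under the integral sign for superpositions of translates of a Schwartz
function. -/
theorem lineDerivOp_eq_integral {K f g : 𝓢(V, ℂ)} {T : V → V} (hT : Continuous T)
    (hf : ∀ x, f x = ∫ z, K z • g (x - T z) ∂μ) (v x : V) :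
    ∂_{v} f x = ∫ z, K z • ∂_{v} g (x - T z) ∂μ := by
  have hcont : Continuous (fderiv ℝ g) := (g.smooth 1).continuous_fderiv one_ne_zero
  have hbound : ∀ x z, ‖K z • fderiv ℝ g (x - T z)‖ ≤
      ‖K z‖ * SchwartzMap.seminorm ℂ 0 1 g := fun x z => by
    rw [norm_smul, ← norm_iteratedFDeriv_one]
    gcongr
    exact norm_iteratedFDeriv_le_seminorm ℂ g 1 _
  have hint : Integrable (fun z => ‖K z‖ * SchwartzMap.seminorm ℂ 0 1 g) μ :=
    K.integrable.norm.mul_const _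
  have hmeas : ∀ x, AEStronglyMeasurable (fun z => K z • fderiv ℝ g (x - T z)) μ := fun x =>
    (K.continuous.smul (hcont.comp (continuous_const.sub hT))).aestronglyMeasurable
  have hmeas' : ∀ x, AEStronglyMeasurable (fun z => K z • g (x - T z)) μ := fun x =>
    (K.continuous.smul (g.continuous.comp (continuous_const.sub hT))).aestronglyMeasurable
  have hderiv : HasFDerivAt (fun x => ∫ z, K z • g (x - T z) ∂μ)
      (∫ z, K z • fderiv ℝ g (x - T z) ∂μ) x :=
    hasFDerivAt_integral_of_dominated_of_fderiv_le
      (F' := fun x z => K z • fderiv ℝ g (x - T z)) Filter.univ_mem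
      (.of_forall hmeas')
      ((K.integrable.norm.mul_const (SchwartzMap.seminorm ℂ 0 0 g)).mono' (hmeas' x)
        (.of_forall fun z => by
          rw [norm_smul]
          gcongr
          exact norm_le_seminorm ℂ g _)) (hmeas x)
      (.of_forall fun z y _ => hbound y z) hint
      (.of_forall fun z y _ =>
        ((g.hasFDerivAt (y - T z)).comp y ((hasFDerivAt_id y).sub_const (T z))).const_smul (K z))
  rw [lineDerivOp_apply_eq_fderiv, show (f : V → ℂ) = _ from funext hf, hderiv.fderiv,
    ContinuousLinearMap.integral_apply (hint.mono' (hmeas x) (.of_forall (hbound x)))]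
  rfl

theorem iteratedFDeriv_eq_integral {K f g : 𝓢(V, ℂ)} {T : V → V} (hT : Continuous T)
    (hf : ∀ x, f x = ∫ z, K z • g (x - T z) ∂μ) (l : ℕ) (x : V) :
    iteratedFDeriv ℝ l f x = ∫ z, K z • iteratedFDeriv ℝ l g (x - T z) ∂μ := by
  have key : ∀ (l : ℕ) (m : Fin l → V) (x : V),
      ∂^{m} f x = ∫ z, K z • ∂^{m} g (x - T z) ∂μ := by
    intro l
    induction l with
    | zero => simpa using hf
    | succ l ih =>
      intro m x
      rw [iteratedLineDerivOp_succ_left, iteratedLineDerivOp_succ_left]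
      exact lineDerivOp_eq_integral hT (ih (Fin.tail m)) (m 0) x
  ext m
  have h1 := (ContinuousMultilinearMap.apply ℝ (fun _ : Fin l => V) ℂ m).integral_comp_comm
    (integrable_smul_iteratedFDeriv_sub (μ := μ) K g hT l x)
  rw [← iteratedLineDerivOp_eq_iteratedFDeriv, key]
  refine Eq.trans ?_ h1
  simp [iteratedLineDerivOp_eq_iteratedFDeriv]

/-- A continuous functional commutes with superpositions of translates of a Schwartz function. -/
theorem apply_eq_integral_compSubConst (u : 𝓢(V, ℂ) →L[ℂ] ℂ) {K f g : 𝓢(V, ℂ)} {T : V → V}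
    (hT : Continuous T) (hTle : ∀ z, ‖T z‖ ≤ ‖T 0‖ + ‖z‖)
    (hf : ∀ x, f x = ∫ z, K z • g (x - T z) ∂μ) :
    u f = ∫ z, K z • u (compSubConstCLM ℂ (T z) g) ∂μ := by
  obtain ⟨s, F, hF⟩ := exists_comp_weightedDerivCLM u
  have hcont : ∀ i : s, Continuous fun z =>
      K z • weightedDerivCLM i.1.1 i.1.2 (compSubConstCLM ℂ (T z) g) := fun i =>
    K.continuous.smul ((weightedDerivCLM i.1.1 i.1.2).continuous.comp
      ((continuous_compSubConstCLM g).comp hT))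
  have hint : ∀ i : s, Integrable (fun z =>
      K z • weightedDerivCLM i.1.1 i.1.2 (compSubConstCLM ℂ (T z) g)) μ := by
    rintro ⟨⟨k, l⟩, hi⟩
    obtain ⟨C, hC0, hC⟩ := exists_seminorm_compSubConst_le g k l
    refine Integrable.mono' (g := fun z => C * ((1 + ‖T 0‖) ^ k * 2 ^ (k - 1)) *
      (‖K z‖ + ‖z‖ ^ k * ‖K z‖)) ((K.integrable.norm.add (K.integrable_pow_mul μ k)).const_mul _)
      (hcont ⟨(k, l), hi⟩).aestronglyMeasurable (.of_forall fun z => ?_)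
    have hT1 : 1 + ‖T z‖ ≤ (1 + ‖T 0‖) * (1 + ‖z‖) := by
      nlinarith [hTle z, norm_nonneg (T 0), norm_nonneg z]
    have h1 : ‖weightedDerivCLM k l (compSubConstCLM ℂ (T z) g)‖ ≤ C * (1 + ‖T z‖) ^ k := by
      rw [norm_weightedDerivCLM]
      refine seminorm_le_bound ℂ k l _ (by positivity) fun x => ?_
      rw [iteratedFDeriv_compSubConstCLM]
      exact hC (T z) x
    rw [norm_smul]
    calc ‖K z‖ * ‖weightedDerivCLM k l (compSubConstCLM ℂ (T z) g)‖
        ≤ ‖K z‖ * (C * ((1 + ‖T 0‖) * (1 + ‖z‖)) ^ k) := by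
          gcongr
          exact h1.trans (by gcongr)
      _ = ‖K z‖ * (C * ((1 + ‖T 0‖) ^ k * (1 + ‖z‖) ^ k)) := by rw [mul_pow]
      _ ≤ ‖K z‖ * (C * ((1 + ‖T 0‖) ^ k * (2 ^ (k - 1) * (1 ^ k + ‖z‖ ^ k)))) := by
          gcongr
          exact add_pow_le zero_le_one (norm_nonneg z) k
      _ = _ := by rw [one_pow]; ring
  have hint' : Integrable (fun z => fun i : s =>
      K z • weightedDerivCLM i.1.1 i.1.2 (compSubConstCLM ℂ (T z) g)) μ :=
    Integrable.of_eval hint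
  have hval : (fun i : s => weightedDerivCLM i.1.1 i.1.2 f) = ∫ z, (fun i : s =>
      K z • weightedDerivCLM i.1.1 i.1.2 (compSubConstCLM ℂ (T z) g)) ∂μ := by
    ext1 i
    refine BoundedForms.ext fun x => ?_
    rw [eval_integral hint, ← ContinuousLinearMap.integral_comp_comm _ (hint i)]
    have hsmul (z : V) : BoundedForms.evalCLM i.1.2 x
        (K z • weightedDerivCLM i.1.1 i.1.2 (compSubConstCLM ℂ (T z) g)) =
        K z • ‖x‖ ^ i.1.1 • iteratedFDeriv ℝ i.1.2 g (x - T z) := by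
      rw [← iteratedFDeriv_compSubConstCLM]
      rfl
    simp only [hsmul, evalCLM_weightedDerivCLM, iteratedFDeriv_eq_integral hT hf]
    rw [← integral_smul]
    exact integral_congr_ae (.of_forall fun z => smul_comm _ _ _)
  rw [hF, hval, ← ContinuousLinearMap.integral_comp_comm _ hint']
  refine integral_congr_ae (.of_forall fun z => ?_)
  simp only [hF]
  exact F.map_smul (K z) _

end SchwartzIntegral

/-! ### Convolution with a tempered distribution -/

section Convolution

variable {n : ℕ}

theorem reflectTranslate_eq_compSubConstCLM (x : EuclideanSpace ℝ (Fin n))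
    (Φ : 𝓢(EuclideanSpace ℝ (Fin n), ℂ)) :
    reflectTranslate x Φ = compSubConstCLM ℂ x (reflectTranslate 0 Φ) := by
  ext y
  rw [reflectTranslate_apply, compSubConstCLM_apply, reflectTranslate_apply, zero_sub, neg_sub]

/-- The Fourier transform of a product is the convolution of the Fourier transforms. -/
theorem fourier_pairing_mul (h φ : 𝓢(EuclideanSpace ℝ (Fin n), ℂ)) :
    𝓕 (pairing (ContinuousLinearMap.mul ℂ ℂ) h φ) =
      SchwartzMap.convolution (ContinuousLinearMap.mul ℂ ℂ) (𝓕 h) (𝓕 φ) := by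
  have h3 (g : 𝓢(EuclideanSpace ℝ (Fin n), ℂ)) : 𝓕⁻ (𝓕 g) = g :=
    FourierTransform.fourierInv_fourier_eq g
  have hneg (g : 𝓢(EuclideanSpace ℝ (Fin n), ℂ)) (x : EuclideanSpace ℝ (Fin n)) :
      𝓕 (𝓕 g) x = g (-x) := by
    conv_rhs => rw [← h3 g, fourierInv_apply_eq]
    simp
  have h2 : 𝓕 (𝓕 (pairing (ContinuousLinearMap.mul ℂ ℂ) h φ)) =
      𝓕 (SchwartzMap.convolution (ContinuousLinearMap.mul ℂ ℂ) (𝓕 h) (𝓕 φ)) := by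
    ext x
    rw [fourier_convolution]
    simp only [hneg, pairing_apply_apply]
  rw [← h3 (𝓕 (pairing (ContinuousLinearMap.mul ℂ ℂ) h φ)), h2, h3]

/-- Convolving a tempered distribution with the Fourier transform of a product `h φ` amounts to
averaging its convolution with `𝓕 φ` against `𝓕 h`. -/
theorem conv_fourier_pairing (h φ : 𝓢(EuclideanSpace ℝ (Fin n), ℂ))
    (f : 𝓢'(EuclideanSpace ℝ (Fin n), ℂ)) (y : EuclideanSpace ℝ (Fin n)) :
    conv (𝓕 (pairing (ContinuousLinearMap.mul ℂ ℂ) h φ)) f y =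
      ∫ z, 𝓕 h z • conv (𝓕 φ) f (y - z) := by
  let u : 𝓢(EuclideanSpace ℝ (Fin n), ℂ) →L[ℂ] ℂ := ⟨f.toLinearMap, map_continuous f⟩
  have key := apply_eq_integral_compSubConst (μ := volume) u
    (K := 𝓕 h) (f := reflectTranslate y (𝓕 (pairing (ContinuousLinearMap.mul ℂ ℂ) h φ)))
    (g := reflectTranslate 0 (𝓕 φ)) (T := fun z => y - z) (by fun_prop)
    (fun z => by simpa using norm_sub_le y z) (fun x => by
      rw [reflectTranslate_apply, fourier_pairing_mul, SchwartzMap.convolution_apply]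
      refine integral_congr_ae (.of_forall fun z => ?_)
      simp only [reflectTranslate_apply, ContinuousLinearMap.mul_apply', smul_eq_mul]
      congr 2
      abel)
  refine Eq.trans key (integral_congr_ae (.of_forall fun z => ?_))
  simp only [conv, reflectTranslate_eq_compSubConstCLM (y - z)]
  rfl

theorem enorm_conv_fourier_pairing_le (h φ : 𝓢(EuclideanSpace ℝ (Fin n), ℂ))
    (f : 𝓢'(EuclideanSpace ℝ (Fin n), ℂ)) (y : EuclideanSpace ℝ (Fin n)) :
    ‖conv (𝓕 (pairing (ContinuousLinearMap.mul ℂ ℂ) h φ)) f y‖ₑ ≤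
      ∫⁻ z, ‖𝓕 h z‖ₑ * ‖conv (𝓕 φ) f (y - z)‖ₑ := by
  rw [conv_fourier_pairing]
  refine (enorm_integral_le_lintegral_enorm _).trans_eq ?_
  simp only [enorm_smul]

end Convolution

/-! ### Seminorms of products with dilated functions -/

section Dilation

variable {V : Type*} [NormedAddCommGroup V] [NormedSpace ℝ V]

/-- A Schwartz seminorm of a product `g φ` is controlled by bounds on the derivatives of `g` on the
support of the Schwartz function `φ`. -/
theorem exists_seminorm_mul_le (φ : 𝓢(V, ℂ)) (k l N : ℕ) :
    ∃ C : ℝ, 0 ≤ C ∧ ∀ (f : 𝓢(V, ℂ)) (g : V → ℂ), ContDiff ℝ (⊤ : ℕ∞) g →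
      (∀ x, f x = g x * φ x) → ∀ A : ℝ, 0 ≤ A →
        (∀ m ≤ l, ∀ x ∈ tsupport φ, ‖iteratedFDeriv ℝ m g x‖ ≤ A * (1 + ‖x‖) ^ N) →
        SchwartzMap.seminorm ℂ k l f ≤ C * A := by
  set S : ℝ := 2 ^ (k + N) *
    (Finset.Iic (k + N, l)).sup (fun m => SchwartzMap.seminorm ℂ m.1 m.2) φ with hS
  have hS0 : 0 ≤ S := by positivity
  refine ⟨∑ i ∈ Finset.range (l + 1), (l.choose i : ℝ) * S, by positivity, ?_⟩
  intro f g hg hf A hA hbound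
  refine seminorm_le_bound ℂ k l f (by positivity) fun x => ?_
  rw [show (f : V → ℂ) = fun x => g x * φ x from funext hf]
  calc ‖x‖ ^ k * ‖iteratedFDeriv ℝ l (fun x => g x * φ x) x‖
      ≤ ‖x‖ ^ k * ∑ i ∈ Finset.range (l + 1),
          (l.choose i : ℝ) * ‖iteratedFDeriv ℝ i g x‖ * ‖iteratedFDeriv ℝ (l - i) φ x‖ := by
        gcongr
        exact norm_iteratedFDeriv_mul_le hg (φ.smooth ⊤) x (mod_cast le_top)
    _ = ∑ i ∈ Finset.range (l + 1), (l.choose i : ℝ) *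
          (‖x‖ ^ k * (‖iteratedFDeriv ℝ i g x‖ * ‖iteratedFDeriv ℝ (l - i) φ x‖)) := by
        rw [Finset.mul_sum]
        exact Finset.sum_congr rfl fun i _ => by ring
    _ ≤ ∑ i ∈ Finset.range (l + 1), (l.choose i : ℝ) * (S * A) := by
        refine Finset.sum_le_sum fun i hi => mul_le_mul_of_nonneg_left ?_ (by positivity)
        by_cases hx : x ∈ tsupport φ
        · calc ‖x‖ ^ k * (‖iteratedFDeriv ℝ i g x‖ * ‖iteratedFDeriv ℝ (l - i) φ x‖)
              ≤ (1 + ‖x‖) ^ k * (A * (1 + ‖x‖) ^ N * ‖iteratedFDeriv ℝ (l - i) φ x‖) := by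
                gcongr
                · linarith
                · exact hbound i (by simpa [Nat.lt_succ_iff] using hi) x hx
            _ = (1 + ‖x‖) ^ (k + N) * ‖iteratedFDeriv ℝ (l - i) φ x‖ * A := by
                rw [pow_add]; ring
            _ ≤ S * A := by
                gcongr
                exact one_add_le_sup_seminorm_apply (𝕜 := ℂ) (m := (k + N, l)) le_rfl
                  (Nat.sub_le l i) φ x
        · have h0 : iteratedFDeriv ℝ (l - i) φ x = 0 :=
            Function.notMem_support.1 fun h => hx (support_iteratedFDeriv_subset _ h)
          rw [h0, norm_zero, mul_zero, mul_zero]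
          positivity
    _ = _ := by rw [Finset.sum_mul]; exact Finset.sum_congr rfl fun i _ => by ring

/-- Taylor's theorem in the form of a bound: if the derivatives of order less than `R` vanish at
the origin, then the derivative of order `m` is of size `‖x‖ ^ (R - m)`. -/
theorem exists_norm_iteratedFDeriv_le_pow {u : V → ℂ} (hu : ContDiff ℝ (⊤ : ℕ∞) u)
    (hb : ∀ m, ∃ B, ∀ x, ‖iteratedFDeriv ℝ m u x‖ ≤ B) {R : ℕ}
    (h0 : ∀ m < R, iteratedFDeriv ℝ m u 0 = 0) (j m : ℕ) (hjm : m + j ≤ R) :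
    ∃ C, 0 ≤ C ∧ ∀ x, ‖iteratedFDeriv ℝ m u x‖ ≤ C * ‖x‖ ^ j := by
  induction j generalizing m with
  | zero =>
    obtain ⟨B, hB⟩ := hb m
    exact ⟨B, (norm_nonneg _).trans (hB 0), by simpa using hB⟩
  | succ j ih =>
    obtain ⟨C, hC0, hC⟩ := ih (m + 1) (by omega)
    refine ⟨C, hC0, fun x => ?_⟩
    have hdiff : Differentiable ℝ (iteratedFDeriv ℝ m u) :=
      hu.differentiable_iteratedFDeriv (mod_cast ENat.natCast_lt_top m)
    have hmvt := Convex.norm_image_sub_le_of_norm_fderiv_le (𝕜 := ℝ)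
      (f := iteratedFDeriv ℝ m u) (C := C * ‖x‖ ^ j) (s := Metric.closedBall 0 ‖x‖)
      (x := 0) (y := x) (fun y _ => hdiff y) (fun y hy => by
        rw [norm_fderiv_iteratedFDeriv]
        refine (hC y).trans ?_
        gcongr
        simpa using hy) (convex_closedBall _ _) (by simp) (by simp)
    rw [h0 m (by omega), sub_zero, sub_zero] at hmvt
    rwa [pow_succ, ← mul_assoc]

theorem norm_iteratedFDeriv_comp_smul {u : V → ℂ} (hu : ContDiff ℝ (⊤ : ℕ∞) u) {t : ℝ}
    (ht : 0 ≤ t) (m : ℕ) (x : V) :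
    ‖iteratedFDeriv ℝ m (fun x => u (t • x)) x‖ = t ^ m * ‖iteratedFDeriv ℝ m u (t • x)‖ := by
  rw [iteratedFDeriv_comp_const_smul t (hu.of_le (mod_cast le_top)), norm_smul, norm_pow,
    Real.norm_of_nonneg ht]

/-- Derivatives of a contraction `u (t •)` of a function vanishing to order `R` at the origin. -/
theorem exists_norm_iteratedFDeriv_comp_smul_le {u : V → ℂ} (hu : ContDiff ℝ (⊤ : ℕ∞) u)
    (hb : ∀ m, ∃ B, ∀ x, ‖iteratedFDeriv ℝ m u x‖ ≤ B) {R : ℕ}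
    (h0 : ∀ m < R, iteratedFDeriv ℝ m u 0 = 0) (l : ℕ) :
    ∃ C, 0 ≤ C ∧ ∀ t : ℝ, 0 < t → t ≤ 1 → ∀ m ≤ l, ∀ x,
      ‖iteratedFDeriv ℝ m (fun x => u (t • x)) x‖ ≤ C * t ^ R * (1 + ‖x‖) ^ R := by
  have key : ∀ m, ∃ C, 0 ≤ C ∧ ∀ t : ℝ, 0 < t → t ≤ 1 → ∀ x,
      ‖iteratedFDeriv ℝ m (fun x => u (t • x)) x‖ ≤ C * t ^ R * (1 + ‖x‖) ^ R := by
    intro m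
    by_cases hm : m ≤ R
    · obtain ⟨C, hC0, hC⟩ := exists_norm_iteratedFDeriv_le_pow hu hb h0 (R - m) m (by omega)
      refine ⟨C, hC0, fun t ht0 ht1 x => ?_⟩
      rw [norm_iteratedFDeriv_comp_smul hu ht0.le]
      calc t ^ m * ‖iteratedFDeriv ℝ m u (t • x)‖
          ≤ t ^ m * (C * (t * ‖x‖) ^ (R - m)) := by
            gcongr
            refine (hC _).trans_eq ?_
            rw [norm_smul, Real.norm_of_nonneg ht0.le]
        _ = C * t ^ R * ‖x‖ ^ (R - m) := by
            conv_rhs => rw [← Nat.add_sub_cancel' hm, pow_add]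
            rw [mul_pow, Nat.add_sub_cancel' hm]; ring
        _ ≤ C * t ^ R * (1 + ‖x‖) ^ (R - m) := by gcongr; linarith
        _ ≤ C * t ^ R * (1 + ‖x‖) ^ R := by
            gcongr
            · linarith [norm_nonneg x]
            · omega
    · obtain ⟨B, hB⟩ := hb m
      have hB0 : 0 ≤ B := (norm_nonneg _).trans (hB 0)
      refine ⟨B, hB0, fun t ht0 ht1 x => ?_⟩
      rw [norm_iteratedFDeriv_comp_smul hu ht0.le]
      calc t ^ m * ‖iteratedFDeriv ℝ m u (t • x)‖ ≤ t ^ R * B := by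
            gcongr ?_ * ?_
            · exact pow_le_pow_of_le_one ht0.le ht1 (by omega)
            · exact hB _
        _ = B * t ^ R * 1 := by ring
        _ ≤ B * t ^ R * (1 + ‖x‖) ^ R := by
            gcongr
            exact one_le_pow₀ (by linarith [norm_nonneg x])
  choose C hC0 hC using key
  refine ⟨∑ m ∈ Finset.range (l + 1), C m, Finset.sum_nonneg fun m _ => hC0 m,
    fun t ht0 ht1 m hm x => (hC m t ht0 ht1 x).trans ?_⟩
  gcongr
  exact Finset.single_le_sum (fun m _ => hC0 m) (Finset.mem_range.2 (by omega))

/-- Derivatives of an expansion `ψ (t •)` of a Schwartz function, away from the origin. -/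
theorem exists_norm_iteratedFDeriv_comp_smul_le_inv (ψ : 𝓢(V, ℂ)) {r : ℝ} (hr : 0 < r)
    (l M : ℕ) :
    ∃ C, 0 ≤ C ∧ ∀ t : ℝ, 1 ≤ t → ∀ m ≤ l, ∀ x, r ≤ ‖x‖ →
      ‖iteratedFDeriv ℝ m (fun x => ψ (t • x)) x‖ ≤ C * (t ^ M)⁻¹ := by
  refine ⟨∑ m ∈ Finset.range (l + 1), SchwartzMap.seminorm ℂ (m + M) m ψ / r ^ (m + M),
    by positivity, fun t ht m hm x hx => ?_⟩
  have ht0 : 0 < t := zero_lt_one.trans_le ht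
  rw [norm_iteratedFDeriv_comp_smul (ψ.smooth ⊤) ht0.le]
  have h1 := le_seminorm ℂ (m + M) m ψ (t • x)
  rw [norm_smul, Real.norm_of_nonneg ht0.le] at h1
  have hs0 : 0 ≤ SchwartzMap.seminorm ℂ (m + M) m ψ := apply_nonneg _ _
  calc t ^ m * ‖iteratedFDeriv ℝ m ψ (t • x)‖
      = (t ^ M)⁻¹ * ((t * r) ^ (m + M) * ‖iteratedFDeriv ℝ m ψ (t • x)‖) / r ^ (m + M) := by
        rw [mul_pow, pow_add t]
        field_simp
    _ ≤ (t ^ M)⁻¹ * SchwartzMap.seminorm ℂ (m + M) m ψ / r ^ (m + M) := by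
        gcongr
        refine le_trans ?_ h1
        gcongr
    _ = SchwartzMap.seminorm ℂ (m + M) m ψ / r ^ (m + M) * (t ^ M)⁻¹ := by ring
    _ ≤ _ := by
        gcongr
        exact Finset.single_le_sum
          (f := fun m => SchwartzMap.seminorm ℂ (m + M) m ψ / r ^ (m + M))
          (fun m _ => by positivity) (Finset.mem_range.2 (by omega))

end Dilation

/-! ### Weighted integrals of Fourier transforms -/

section WeightedIntegral

variable {n : ℕ}

theorem one_add_rpow_le {a : ℝ} (s : ℝ) (hs : 0 ≤ s) (A : ℕ) (hA : a ≤ A) (ha : 0 < a) :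
    1 + s ^ a ≤ 2 + s ^ A := by
  rcases le_total s 1 with h | h
  · have := Real.rpow_le_one hs h ha.le
    have := pow_nonneg hs A
    linarith
  · have := Real.rpow_le_rpow_of_exponent_le h hA
    rw [Real.rpow_natCast] at this
    linarith

/-- Weighted `L¹` norms of the Fourier transform are controlled by Schwartz seminorms. -/
theorem exists_lintegral_fourier_le {a : ℝ} (ha : 0 < a) :
    ∃ (s : Finset (ℕ × ℕ)) (C : ℝ), 0 ≤ C ∧ ∀ h : 𝓢(EuclideanSpace ℝ (Fin n), ℂ),
      ∫⁻ z, ‖𝓕 h z‖ₑ * ENNReal.ofReal (1 + ‖(2 : ℝ) • z‖ ^ a) ≤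
        ENNReal.ofReal (C * s.sup (schwartzSeminormFamily ℂ (EuclideanSpace ℝ (Fin n)) ℂ) h) := by
  obtain ⟨A, hA⟩ := exists_nat_ge a
  let P := (volume : Measure (EuclideanSpace ℝ (Fin n))).integrablePower
  let D : ℝ := 2 ^ P * ∫ x : EuclideanSpace ℝ (Fin n), (1 + ‖x‖) ^ (-(P : ℝ))
  have hD0 : 0 ≤ D := by
    have : 0 ≤ ∫ x : EuclideanSpace ℝ (Fin n), (1 + ‖x‖) ^ (-(P : ℝ)) :=
      integral_nonneg fun x => by positivity
    positivity
  let q : Seminorm ℂ 𝓢(EuclideanSpace ℝ (Fin n), ℂ) :=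
    SchwartzMap.seminorm ℂ 0 0 + SchwartzMap.seminorm ℂ P 0 + SchwartzMap.seminorm ℂ (A + P) 0
  have hcont (k : ℕ) : Continuous (SchwartzMap.seminorm ℂ k 0 :
      Seminorm ℂ 𝓢(EuclideanSpace ℝ (Fin n), ℂ)) :=
    (schwartz_withSeminorms ℂ _ ℂ).continuous_seminorm (k, 0)
  have hqcont : Continuous q := ((hcont 0).add (hcont P)).add (hcont (A + P))
  obtain ⟨s, C, -, hC⟩ := Seminorm.bound_of_continuous
    (schwartz_withSeminorms ℂ (EuclideanSpace ℝ (Fin n)) ℂ)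
    (q.comp (fourierCLM ℂ 𝓢(EuclideanSpace ℝ (Fin n), ℂ)).toLinearMap)
    (hqcont.comp (fourierCLM ℂ 𝓢(EuclideanSpace ℝ (Fin n), ℂ)).continuous)
  refine ⟨s, (2 * D + 2 ^ A * D) * C, by positivity, fun h => ?_⟩
  have hint0 := (𝓕 h).integrable_pow_mul volume 0
  have hintA := (𝓕 h).integrable_pow_mul volume A
  have hle (k : ℕ) (hk : SchwartzMap.seminorm ℂ 0 0 (𝓕 h) +
      SchwartzMap.seminorm ℂ (k + P) 0 (𝓕 h) ≤ q (𝓕 h)) :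
      ∫ z, ‖z‖ ^ k * ‖𝓕 h z‖ ≤ D * q (𝓕 h) := by
    have h1 := integral_pow_mul_iteratedFDeriv_le ℂ volume (𝓕 h) k 0
    simp only [norm_iteratedFDeriv_zero] at h1
    exact h1.trans (mul_le_mul_of_nonneg_left hk hD0)
  have hs0 (k : ℕ) : 0 ≤ SchwartzMap.seminorm ℂ k 0 (𝓕 h) := apply_nonneg _ _
  have hCh : q (𝓕 h) ≤ C * s.sup (schwartzSeminormFamily ℂ (EuclideanSpace ℝ (Fin n)) ℂ) h := hC h
  calc ∫⁻ z, ‖𝓕 h z‖ₑ * ENNReal.ofReal (1 + ‖(2 : ℝ) • z‖ ^ a)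
      ≤ ∫⁻ z, ENNReal.ofReal (2 * (‖z‖ ^ 0 * ‖𝓕 h z‖) + 2 ^ A * (‖z‖ ^ A * ‖𝓕 h z‖)) := by
        refine lintegral_mono fun z => ?_
        rw [← ofReal_norm, ← ENNReal.ofReal_mul (norm_nonneg _)]
        refine ENNReal.ofReal_le_ofReal ?_
        have h1 := one_add_rpow_le ‖(2 : ℝ) • z‖ (norm_nonneg _) A hA ha
        rw [norm_smul ((2 : ℝ)), mul_pow, Real.norm_two] at h1
        have h2 := mul_le_mul_of_nonneg_left h1 (norm_nonneg (𝓕 h z))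
        rw [norm_smul, Real.norm_two]
        refine h2.trans_eq ?_
        ring
    _ = ENNReal.ofReal (∫ z, (2 * (‖z‖ ^ 0 * ‖𝓕 h z‖) + 2 ^ A * (‖z‖ ^ A * ‖𝓕 h z‖))) := by
        rw [ofReal_integral_eq_lintegral_ofReal]
        · exact (hint0.const_mul 2).add (hintA.const_mul (2 ^ A))
        · exact .of_forall fun z => by positivity
    _ ≤ _ := by
        refine ENNReal.ofReal_le_ofReal ?_
        rw [integral_add (hint0.const_mul 2) (hintA.const_mul (2 ^ A)), integral_const_mul,
          integral_const_mul]
        have h0 := hle 0 (by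
          rw [zero_add]
          exact le_add_of_nonneg_right (hs0 (A + P)))
        have h1 := hle A (by
          change _ ≤ SchwartzMap.seminorm ℂ 0 0 (𝓕 h) + SchwartzMap.seminorm ℂ P 0 (𝓕 h) +
            SchwartzMap.seminorm ℂ (A + P) 0 (𝓕 h)
          linarith [hs0 P])
        calc _ ≤ 2 * (D * q (𝓕 h)) + 2 ^ A * (D * q (𝓕 h)) := by gcongr
          _ = (2 * D + 2 ^ A * D) * q (𝓕 h) := by ring
          _ ≤ _ := by
            rw [mul_assoc]
            exact mul_le_mul_of_nonneg_left hCh (by positivity)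

theorem fourier_dilate (j : ℕ) (h : 𝓢(EuclideanSpace ℝ (Fin n), ℂ))
    (z : EuclideanSpace ℝ (Fin n)) :
    𝓕 (dilate j h) z = ((2 : ℝ) ^ j) ^ n • 𝓕 h ((2 : ℝ) ^ j • z) := by
  rw [fourier_coe, fourier_coe, Real.fourier_eq, Real.fourier_eq]
  have h1 := Measure.integral_comp_smul (volume : Measure (EuclideanSpace ℝ (Fin n)))
    (fun v => Real.fourierChar (-inner ℝ v ((2 : ℝ) ^ j • z)) • h v) ((2 : ℝ) ^ (-(j : ℤ)))
  have h2 : |(((2 : ℝ) ^ (-(j : ℤ))) ^ Module.finrank ℝ (EuclideanSpace ℝ (Fin n)))⁻¹| =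
      ((2 : ℝ) ^ j) ^ n := by
    rw [finrank_euclideanSpace_fin, zpow_neg, zpow_natCast, inv_pow, inv_inv, abs_of_pos]
    positivity
  rw [h2] at h1
  rw [← h1]
  refine integral_congr_ae (.of_forall fun v => ?_)
  simp only [dilate_apply]
  congr 3
  rw [inner_smul_left, inner_smul_right, ← mul_assoc]
  simp

theorem lintegral_fourier_dilate (j : ℕ) (h : 𝓢(EuclideanSpace ℝ (Fin n), ℂ))
    {W : EuclideanSpace ℝ (Fin n) → ℝ≥0∞} (hW : Measurable W) :
    ∫⁻ z, ‖𝓕 (dilate j h) z‖ₑ * W ((2 : ℝ) ^ j • z) = ∫⁻ z, ‖𝓕 h z‖ₑ * W z := by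
  have h2 : ((2 : ℝ) ^ j) ^ n ≠ 0 := by positivity
  have hmeas : Measurable fun z => ‖𝓕 h z‖ₑ * W z :=
    ((𝓕 h).continuous.measurable.enorm).mul hW
  have h1 := lintegral_map (μ := (volume : Measure (EuclideanSpace ℝ (Fin n)))) hmeas
    (measurable_const_smul ((2 : ℝ) ^ j))
  rw [Measure.map_addHaar_smul _ (by positivity), lintegral_smul_measure,
    finrank_euclideanSpace_fin, abs_of_pos (by positivity)] at h1
  calc ∫⁻ z, ‖𝓕 (dilate j h) z‖ₑ * W ((2 : ℝ) ^ j • z)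
      = ∫⁻ z, ENNReal.ofReal (((2 : ℝ) ^ j) ^ n) *
          (‖𝓕 h ((2 : ℝ) ^ j • z)‖ₑ * W ((2 : ℝ) ^ j • z)) := by
        refine lintegral_congr fun z => ?_
        rw [fourier_dilate, enorm_smul, Real.enorm_of_nonneg (by positivity), mul_assoc]
    _ = ENNReal.ofReal (((2 : ℝ) ^ j) ^ n) *
          ∫⁻ z, ‖𝓕 h ((2 : ℝ) ^ j • z)‖ₑ * W ((2 : ℝ) ^ j • z) := by
        rw [lintegral_const_mul' _ _ ENNReal.ofReal_ne_top]
    _ = _ := by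
        rw [← h1, smul_eq_mul, ← mul_assoc, ← ENNReal.ofReal_mul (by positivity),
          mul_inv_cancel₀ h2, ENNReal.ofReal_one, one_mul]

end WeightedIntegral

/-! ### A smooth dyadic resolution of unity -/

section Resolution

variable {n : ℕ}

/-- Multiplication by the dilates of a Schwartz function with value one at the origin converges to
the identity. -/
theorem tendsto_pairing_dilate {χ : 𝓢(EuclideanSpace ℝ (Fin n), ℂ)} (hχ : χ 0 = 1)
    (ψ : 𝓢(EuclideanSpace ℝ (Fin n), ℂ)) :
    Filter.Tendsto (fun N => pairing (ContinuousLinearMap.mul ℂ ℂ) (dilate N χ) ψ)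
      Filter.atTop (nhds ψ) := by
  rw [(schwartz_withSeminorms ℂ (EuclideanSpace ℝ (Fin n)) ℂ).tendsto_nhds _ _]
  rintro ⟨k, l⟩ ε hε
  let u : EuclideanSpace ℝ (Fin n) → ℂ := fun x => χ x - 1
  have hu : ContDiff ℝ (⊤ : ℕ∞) u := (χ.smooth ⊤).sub contDiff_const
  have hb : ∀ m, ∃ B, ∀ x, ‖iteratedFDeriv ℝ m u x‖ ≤ B := fun m => by
    refine ⟨SchwartzMap.seminorm ℂ 0 m χ + 1, fun x => ?_⟩
    have h1 : iteratedFDeriv ℝ m u x = iteratedFDeriv ℝ m χ x -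
        iteratedFDeriv ℝ m (fun _ : EuclideanSpace ℝ (Fin n) => (1 : ℂ)) x :=
      iteratedFDeriv_sub_apply (χ.contDiffAt m) contDiffAt_const
    rw [h1]
    refine (norm_sub_le _ _).trans (add_le_add (norm_iteratedFDeriv_le_seminorm ℂ χ m x) ?_)
    rcases eq_or_ne m 0 with rfl | hm
    · simp
    · simp [iteratedFDeriv_const_of_ne hm]
  obtain ⟨C₁, hC₁0, hC₁⟩ := exists_norm_iteratedFDeriv_comp_smul_le hu hb (R := 1) (fun m hm => by
    obtain rfl : m = 0 := by omega
    ext v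
    simp [u, hχ]) l
  obtain ⟨C₂, hC₂0, hC₂⟩ := exists_seminorm_mul_le ψ k l 1
  have hlim : Filter.Tendsto (fun N : ℕ => C₂ * (C₁ * ((1 / 2 : ℝ) ^ N) ^ 1)) Filter.atTop
      (nhds 0) := by
    have := (((tendsto_pow_atTop_nhds_zero_of_lt_one (r := (1 / 2 : ℝ)) (by norm_num)
      (by norm_num)).pow 1).const_mul C₁).const_mul C₂
    simpa using this
  filter_upwards [hlim.eventually_lt_const hε] with N hN
  refine lt_of_le_of_lt ?_ hN
  refine hC₂ _ (fun x => u ((1 / 2 : ℝ) ^ N • x)) (hu.comp (contDiff_const_smul _)) (fun x => ?_) _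
    (by positivity) (fun m hm x _ => hC₁ _ (by positivity) (pow_le_one₀ (by norm_num) (by norm_num))
      m hm x)
  rw [sub_apply, pairing_apply_apply, dilate_apply, ContinuousLinearMap.mul_apply']
  simp only [u, one_div, inv_pow, zpow_neg, zpow_natCast]
  ring

theorem contDiff_div_of_tsupport {V : Type*} [NormedAddCommGroup V] [NormedSpace ℝ V]
    {m : WithTop ℕ∞} {μ φ : V → ℂ} (hμ : ContDiff ℝ m μ) (hφ : ContDiff ℝ m φ)
    (h : ∀ x ∈ tsupport μ, φ x ≠ 0) : ContDiff ℝ m fun x => μ x / φ x := by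
  rw [contDiff_iff_contDiffAt]
  intro x
  by_cases hx : x ∈ tsupport μ
  · simp only [div_eq_mul_inv]
    exact hμ.contDiffAt.mul (hφ.contDiffAt.inv (h x hx))
  · refine (contDiffAt_const (c := (0 : ℂ))).congr_of_eventuallyEq ?_
    filter_upwards [notMem_tsupport_iff_eventuallyEq.1 hx] with y hy
    simp [hy]

/-- Division of a smooth compactly supported function by a Schwartz function without zeros on its
support. -/
theorem exists_schwartz_mul_eq {μ : EuclideanSpace ℝ (Fin n) → ℂ} (hμ : ContDiff ℝ (⊤ : ℕ∞) μ)
    (hc : HasCompactSupport μ) (φ : 𝓢(EuclideanSpace ℝ (Fin n), ℂ))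
    (h : ∀ x ∈ tsupport μ, φ x ≠ 0) :
    ∃ lam : 𝓢(EuclideanSpace ℝ (Fin n), ℂ), (∀ x, lam x * φ x = μ x) ∧
      tsupport lam ⊆ tsupport μ := by
  have hsub : Function.support (fun x => μ x / φ x) ⊆ Function.support μ := fun x hx hx0 =>
    hx (by simp [hx0])
  refine ⟨HasCompactSupport.toSchwartzMap (f := fun x => μ x / φ x) (hc.mono hsub)
    (contDiff_div_of_tsupport hμ (φ.smooth ⊤) h), fun x => ?_, closure_mono hsub⟩
  change μ x / φ x * φ x = μ x
  by_cases hx : x ∈ tsupport μ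
  · exact div_mul_cancel₀ _ (h x hx)
  · simp [image_eq_zero_of_notMem_tsupport hx]

/-- A Calderon reproducing formula: under the Tauberian conditions there are Schwartz functions
`lam₀`, `lam₁` for which the products of the dyadic families of `lam` and `φ` are the differences
of consecutive dilates of a Schwartz function `χ` with `χ 0 = 1`. -/
theorem exists_resolution {φ₀ φ₁ : 𝓢(EuclideanSpace ℝ (Fin n), ℂ)} {ε : ℝ} (hε : 0 < ε)
    (h₀ : ∀ x, ‖x‖ < ε → 0 < ‖φ₀ x‖) (h₁ : ∀ x, ε / 2 < ‖x‖ → ‖x‖ < 2 * ε → 0 < ‖φ₁ x‖) :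
    ∃ χ lam₀ lam₁ : 𝓢(EuclideanSpace ℝ (Fin n), ℂ), χ 0 = 1 ∧ (∀ x, lam₀ x * φ₀ x = χ x) ∧
      (∀ x, lam₁ x * φ₁ x = χ ((2 : ℝ)⁻¹ • x) - χ x) ∧
      ∃ r, 0 < r ∧ ∀ x ∈ tsupport lam₁, r ≤ ‖x‖ := by
  -- with these radii `b` is supported in `‖x‖ < ε`, and `b (x / 2) - b x` in
  -- `3 ε / 4 ≤ ‖x‖ ≤ 7 ε / 4`, inside the annulus where `φ₁` does not vanish
  let b : ContDiffBump (0 : EuclideanSpace ℝ (Fin n)) :=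
    ⟨3 * ε / 4, 7 * ε / 8, by positivity, by linarith⟩
  let χ : EuclideanSpace ℝ (Fin n) → ℂ := fun x => (b x : ℂ)
  have hχ1 : ∀ x, ‖x‖ ≤ 3 * ε / 4 → χ x = 1 := fun x hx => by
    simp only [χ, b.one_of_mem_closedBall (mem_closedBall_zero_iff.2 hx), Complex.ofReal_one]
  have hχ0 : ∀ x, 7 * ε / 8 ≤ ‖x‖ → χ x = 0 := fun x hx => by
    simp only [χ, b.zero_of_le_dist (by rw [dist_zero_right]; exact hx), Complex.ofReal_zero]
  have hχs : ContDiff ℝ (⊤ : ℕ∞) χ := Complex.ofRealCLM.contDiff.comp b.contDiff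
  have hsupp : tsupport χ ⊆ Metric.closedBall 0 (7 * ε / 8) := by
    refine closure_minimal (fun x hx => ?_) Metric.isClosed_closedBall
    by_contra hx'
    rw [mem_closedBall_zero_iff, not_le] at hx'
    exact hx (hχ0 x hx'.le)
  have hχc : HasCompactSupport χ :=
    HasCompactSupport.of_support_subset_isCompact (isCompact_closedBall 0 (7 * ε / 8))
      ((subset_tsupport _).trans hsupp)
  let μ : EuclideanSpace ℝ (Fin n) → ℂ := fun x => χ ((2 : ℝ)⁻¹ • x) - χ x
  have hμs : ContDiff ℝ (⊤ : ℕ∞) μ := (hχs.comp (contDiff_const_smul _)).sub hχs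
  have hμsupp : tsupport μ ⊆ {x | 3 * ε / 4 ≤ ‖x‖ ∧ ‖x‖ ≤ 7 * ε / 4} := by
    refine closure_minimal (fun x hx => ?_) ((isClosed_le continuous_const continuous_norm).inter
      (isClosed_le continuous_norm continuous_const))
    have hnorm : ‖(2 : ℝ)⁻¹ • x‖ = ‖x‖ / 2 := by
      rw [norm_smul, norm_inv, Real.norm_two]; ring
    refine ⟨?_, ?_⟩
    · by_contra! hlt
      refine hx ?_
      simp only [μ]
      rw [hχ1 _ (by rw [hnorm]; linarith [norm_nonneg x]), hχ1 x hlt.le, sub_self]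
    · by_contra! hlt
      refine hx ?_
      simp only [μ]
      rw [hχ0 _ (by rw [hnorm]; linarith), hχ0 x (by linarith), sub_self]
  have hμc : HasCompactSupport μ :=
    HasCompactSupport.of_support_subset_isCompact (isCompact_closedBall 0 (7 * ε / 4))
      fun x hx => mem_closedBall_zero_iff.2 (hμsupp (subset_tsupport _ hx)).2
  obtain ⟨lam₀, hlam₀, -⟩ := exists_schwartz_mul_eq hχs hχc φ₀ fun x hx =>
    norm_pos_iff.1 (h₀ x (by have := mem_closedBall_zero_iff.1 (hsupp hx); linarith))
  obtain ⟨lam₁, hlam₁, hlam₁s⟩ := exists_schwartz_mul_eq hμs hμc φ₁ fun x hx =>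
    norm_pos_iff.1 (h₁ x (by linarith [(hμsupp hx).1]) (by linarith [(hμsupp hx).2]))
  exact ⟨hχc.toSchwartzMap hχs, lam₀, lam₁, hχ1 0 (by simp; positivity), hlam₀, hlam₁,
    3 * ε / 4, by positivity, fun x hx => (hμsupp (hlam₁s hx)).1⟩

theorem sum_pairing_dyadic {χ lam₀ lam₁ φ₀ φ₁ : 𝓢(EuclideanSpace ℝ (Fin n), ℂ)}
    (h₀ : ∀ x, lam₀ x * φ₀ x = χ x)
    (h₁ : ∀ x, lam₁ x * φ₁ x = χ ((2 : ℝ)⁻¹ • x) - χ x)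
    (ψ : 𝓢(EuclideanSpace ℝ (Fin n), ℂ)) (N : ℕ) :
    ∑ k ∈ Finset.range (N + 1), pairing (ContinuousLinearMap.mul ℂ ℂ)
      (pairing (ContinuousLinearMap.mul ℂ ℂ) ψ (dyadic lam₀ lam₁ k)) (dyadic φ₀ φ₁ k) =
      pairing (ContinuousLinearMap.mul ℂ ℂ) (dilate N χ) ψ := by
  induction N with
  | zero =>
    ext x
    simp [dyadic, dilate_apply, ← h₀]
    ring
  | succ N ih =>
    rw [Finset.sum_range_succ, ih]
    ext x
    have h2 := h₁ ((2 : ℝ) ^ (-(N : ℤ)) • x)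
    have h3 : (2 : ℝ)⁻¹ • (2 : ℝ) ^ (-(N : ℤ)) • x = (2 : ℝ) ^ (-((N + 1 : ℕ) : ℤ)) • x := by
      rw [smul_smul]
      congr 1
      simp only [zpow_neg, zpow_natCast, pow_succ, mul_inv]
      ring
    rw [h3] at h2
    simp only [add_apply, pairing_apply_apply, ContinuousLinearMap.mul_apply', dyadic,
      dilate_apply]
    linear_combination (ψ x) * h2

end Resolution

/-! ### Almost orthogonality of the kernels -/

section Kernel

variable {n : ℕ}

/-- The contraction `x ↦ F (2 ^ j x)`, inverse to `dilate j`. -/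
noncomputable def undilate (j : ℕ) (F : 𝓢(EuclideanSpace ℝ (Fin n), ℂ)) :
    𝓢(EuclideanSpace ℝ (Fin n), ℂ) :=
  compCLMOfContinuousLinearEquiv ℂ (ContinuousLinearEquiv.smulLeft (R₁ := ℝ)
    (Units.mk0 ((2 : ℝ) ^ j) (by positivity))) F

theorem undilate_apply (j : ℕ) (F : 𝓢(EuclideanSpace ℝ (Fin n), ℂ))
    (x : EuclideanSpace ℝ (Fin n)) : undilate j F x = F ((2 : ℝ) ^ j • x) := rfl

theorem dilate_undilate (j : ℕ) (F : 𝓢(EuclideanSpace ℝ (Fin n), ℂ)) :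
    dilate j (undilate j F) = F := by
  ext x
  rw [dilate_apply, undilate_apply, smul_smul, zpow_neg, zpow_natCast,
    mul_inv_cancel₀ (by positivity), one_smul]

theorem lintegral_fourier_le_undilate {a : ℝ} (ha : 0 < a) (F : 𝓢(EuclideanSpace ℝ (Fin n), ℂ))
    {j k : ℕ} (hjk : k ≤ j + 1) :
    ∫⁻ z, ‖𝓕 F z‖ₑ * ENNReal.ofReal (1 + ‖(2 : ℝ) ^ k • z‖ ^ a) ≤
      ∫⁻ z, ‖𝓕 (undilate j F) z‖ₑ * ENNReal.ofReal (1 + ‖(2 : ℝ) • z‖ ^ a) := by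
  have hW : Measurable fun z : EuclideanSpace ℝ (Fin n) =>
      ENNReal.ofReal (1 + ‖(2 : ℝ) • z‖ ^ a) := by fun_prop
  rw [← lintegral_fourier_dilate j (undilate j F) hW, dilate_undilate]
  refine lintegral_mono fun z => ?_
  gcongr
  rw [smul_smul, ← pow_succ', norm_smul, norm_smul]
  gcongr
  rw [norm_pow, norm_pow, Real.norm_two]
  exact pow_le_pow_right₀ (by norm_num) hjk

/-- If the derivatives of `ψ` of order less than `R` vanish at the origin, Taylor's formula bounds
all Schwartz seminorms of `x ↦ ψ (t • x) * lam x` by `t ^ R` as `t → 0`; the decay of `lam`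
compensates the growth of the remainder. -/
theorem exists_lintegral_fourier_mul_le {a : ℝ} (ha : 0 < a)
    (ψ lam : 𝓢(EuclideanSpace ℝ (Fin n), ℂ)) {R : ℕ}
    (h0 : ∀ m < R, iteratedFDeriv ℝ m ψ 0 = 0) :
    ∃ C : ℝ, 0 ≤ C ∧ ∀ t : ℝ, 0 < t → t ≤ 1 → ∀ H : 𝓢(EuclideanSpace ℝ (Fin n), ℂ),
      (∀ x, H x = ψ (t • x) * lam x) →
      ∫⁻ z, ‖𝓕 H z‖ₑ * ENNReal.ofReal (1 + ‖(2 : ℝ) • z‖ ^ a) ≤ ENNReal.ofReal (C * t ^ R) := by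
  obtain ⟨s, C, hC0, hC⟩ := exists_lintegral_fourier_le (n := n) ha
  have key : ∀ i : ℕ × ℕ, ∃ D : ℝ, 0 ≤ D ∧ ∀ t : ℝ, 0 < t → t ≤ 1 →
      ∀ H : 𝓢(EuclideanSpace ℝ (Fin n), ℂ), (∀ x, H x = ψ (t • x) * lam x) →
      SchwartzMap.seminorm ℂ i.1 i.2 H ≤ D * t ^ R := by
    rintro ⟨k, l⟩
    obtain ⟨C₁, hC₁0, hC₁⟩ := exists_norm_iteratedFDeriv_comp_smul_le (ψ.smooth ⊤)
      (fun m => ⟨_, norm_iteratedFDeriv_le_seminorm ℂ ψ m⟩) h0 l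
    obtain ⟨C₂, hC₂0, hC₂⟩ := exists_seminorm_mul_le lam k l R
    refine ⟨C₂ * C₁, by positivity, fun t ht0 ht1 H hH => ?_⟩
    rw [mul_assoc]
    exact hC₂ H (fun x => ψ (t • x)) ((ψ.smooth ⊤).comp (contDiff_const_smul t)) hH _
      (by positivity) fun m hm x _ => hC₁ t ht0 ht1 m hm x
  choose D hD0 hD using key
  refine ⟨C * ∑ i ∈ s, D i, mul_nonneg hC0 (Finset.sum_nonneg fun i _ => hD0 i),
    fun t ht0 ht1 H hH => (hC H).trans (ENNReal.ofReal_le_ofReal ?_)⟩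
  rw [mul_assoc]
  gcongr
  have hsum : 0 ≤ ∑ i ∈ s, D i := Finset.sum_nonneg fun i _ => hD0 i
  refine Seminorm.finset_sup_apply_le (by positivity) fun i hi => (hD i t ht0 ht1 H hH).trans ?_
  gcongr
  exact Finset.single_le_sum (fun i _ => hD0 i) hi

/-- On the support of `lam` the argument of `ψ (t • x)` has norm at least `t * r`, so the rapid decay
of `ψ` yields every negative power of `t`. -/
theorem exists_lintegral_fourier_mul_le_inv {a : ℝ} (ha : 0 < a)
    (ψ lam : 𝓢(EuclideanSpace ℝ (Fin n), ℂ)) {r : ℝ} (hr : 0 < r)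
    (hlam : ∀ x ∈ tsupport lam, r ≤ ‖x‖) (M : ℕ) :
    ∃ C : ℝ, 0 ≤ C ∧ ∀ t : ℝ, 1 ≤ t → ∀ H : 𝓢(EuclideanSpace ℝ (Fin n), ℂ),
      (∀ x, H x = ψ (t • x) * lam x) →
      ∫⁻ z, ‖𝓕 H z‖ₑ * ENNReal.ofReal (1 + ‖(2 : ℝ) • z‖ ^ a) ≤
        ENNReal.ofReal (C * (t ^ M)⁻¹) := by
  obtain ⟨s, C, hC0, hC⟩ := exists_lintegral_fourier_le (n := n) ha
  have key : ∀ i : ℕ × ℕ, ∃ D : ℝ, 0 ≤ D ∧ ∀ t : ℝ, 1 ≤ t →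
      ∀ H : 𝓢(EuclideanSpace ℝ (Fin n), ℂ), (∀ x, H x = ψ (t • x) * lam x) →
      SchwartzMap.seminorm ℂ i.1 i.2 H ≤ D * (t ^ M)⁻¹ := by
    rintro ⟨k, l⟩
    obtain ⟨C₁, hC₁0, hC₁⟩ := exists_norm_iteratedFDeriv_comp_smul_le_inv ψ hr l M
    obtain ⟨C₂, hC₂0, hC₂⟩ := exists_seminorm_mul_le lam k l 0
    refine ⟨C₂ * C₁, by positivity, fun t ht H hH => ?_⟩
    have ht0 : 0 < t := zero_lt_one.trans_le ht
    rw [mul_assoc]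
    exact hC₂ H (fun x => ψ (t • x)) ((ψ.smooth ⊤).comp (contDiff_const_smul t)) hH _
      (by positivity) fun m hm x hx => by simpa using hC₁ t ht m hm x (hlam x hx)
  choose D hD0 hD using key
  refine ⟨C * ∑ i ∈ s, D i, mul_nonneg hC0 (Finset.sum_nonneg fun i _ => hD0 i),
    fun t ht H hH => (hC H).trans (ENNReal.ofReal_le_ofReal ?_)⟩
  have ht0 : 0 < t := zero_lt_one.trans_le ht
  rw [mul_assoc]
  gcongr
  have hsum : 0 ≤ ∑ i ∈ s, D i := Finset.sum_nonneg fun i _ => hD0 i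
  refine Seminorm.finset_sup_apply_le (by positivity) fun i hi => (hD i t ht H hH).trans ?_
  gcongr
  exact Finset.single_le_sum (fun i _ => hD0 i) hi

/-- Almost orthogonality: moment conditions on `ψ₁` give decay of order `R` if `lam` has the lower
frequency; if it has the higher one, the decay is of any order `M`, as `lam₁` is supported away
from the origin. -/
theorem exists_lintegral_fourier_dyadic_le {a : ℝ} (ha : 0 < a)
    (ψ₀ ψ₁ lam₀ lam₁ : 𝓢(EuclideanSpace ℝ (Fin n), ℂ)) {R : ℕ}
    (h0 : ∀ m < R, iteratedFDeriv ℝ m ψ₁ 0 = 0) {r : ℝ} (hr : 0 < r)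
    (hlam : ∀ x ∈ tsupport lam₁, r ≤ ‖x‖) (M : ℕ) :
    ∃ C : ℝ, 0 ≤ C ∧
      (∀ k d : ℕ, ∫⁻ z, ‖𝓕 (pairing (ContinuousLinearMap.mul ℂ ℂ) (dyadic ψ₀ ψ₁ (k + d))
          (dyadic lam₀ lam₁ k)) z‖ₑ * ENNReal.ofReal (1 + ‖(2 : ℝ) ^ k • z‖ ^ a) ≤
        ENNReal.ofReal (C * ((1 / 2) ^ d) ^ R)) ∧
      (∀ ν d : ℕ, ∫⁻ z, ‖𝓕 (pairing (ContinuousLinearMap.mul ℂ ℂ) (dyadic ψ₀ ψ₁ ν)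
          (dyadic lam₀ lam₁ (ν + (d + 1)))) z‖ₑ *
            ENNReal.ofReal (1 + ‖(2 : ℝ) ^ (ν + (d + 1)) • z‖ ^ a) ≤
        ENNReal.ofReal (C * ((1 / 2) ^ (d + 1)) ^ M)) := by
  obtain ⟨C₁, hC₁0, hC₁⟩ := exists_lintegral_fourier_mul_le ha ψ₁ lam₀ h0
  obtain ⟨C₂, hC₂0, hC₂⟩ := exists_lintegral_fourier_mul_le ha ψ₁ lam₁ h0
  obtain ⟨C₃, hC₃0, hC₃⟩ := exists_lintegral_fourier_mul_le (R := 0) ha ψ₀ lam₀ (by simp)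
  obtain ⟨C₄, hC₄0, hC₄⟩ := exists_lintegral_fourier_mul_le_inv ha ψ₀ lam₁ hr hlam M
  obtain ⟨C₅, hC₅0, hC₅⟩ := exists_lintegral_fourier_mul_le_inv ha ψ₁ lam₁ hr hlam M
  have h1R : (1 : ℝ) ≤ 2 ^ R := one_le_pow₀ (by norm_num)
  have h1M : (1 : ℝ) ≤ 2 ^ M := one_le_pow₀ (by norm_num)
  refine ⟨C₁ * 2 ^ R + C₂ + C₃ + C₄ * 2 ^ M + C₅, by positivity, fun k d => ?_, fun ν d => ?_⟩
  · rcases k with _ | k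
    · refine (lintegral_fourier_le_undilate ha _ (j := 0) (by omega)).trans ?_
      rcases d with _ | d
      · refine (hC₃ 1 one_pos le_rfl _ fun x => ?_).trans (ENNReal.ofReal_le_ofReal ?_)
        · simp [undilate_apply, dyadic]
        · simp only [pow_zero, one_pow, mul_one]
          nlinarith
      · refine (hC₁ ((1 / 2) ^ d) (by positivity) (pow_le_one₀ (by norm_num) (by norm_num)) _
          fun x => ?_).trans (ENNReal.ofReal_le_ofReal ?_)
        · simp [undilate_apply, dyadic, dilate_apply]
        · calc C₁ * ((1 / 2) ^ d) ^ R = C₁ * 2 ^ R * ((1 / 2) ^ (d + 1)) ^ R := by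
                rw [pow_succ, mul_pow, mul_assoc, mul_comm (_ ^ R) ((1 / 2) ^ R), ← mul_assoc (2 ^ R),
                  ← mul_pow]
                norm_num
            _ ≤ _ := by
                gcongr
                have : 0 ≤ C₄ * 2 ^ M := by positivity
                linarith
    · refine (lintegral_fourier_le_undilate ha _ (j := k) le_rfl).trans ?_
      refine (hC₂ ((1 / 2) ^ d) (by positivity) (pow_le_one₀ (by norm_num) (by norm_num)) _
        fun x => ?_).trans (ENNReal.ofReal_le_ofReal ?_)
      · rw [show k + 1 + d = (k + d) + 1 by ring, undilate_apply, pairing_apply_apply,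
          ContinuousLinearMap.mul_apply']
        simp only [dyadic, dilate_apply, smul_smul, zpow_neg, zpow_natCast]
        congr 3
        · rw [pow_add, one_div, inv_pow]
          field_simp
        · rw [inv_mul_cancel₀ (by positivity), one_smul]
      · gcongr
        have : 0 ≤ C₄ * 2 ^ M := by positivity
        have : 0 ≤ C₁ * 2 ^ R := by positivity
        linarith
  · rcases ν with _ | ν
    · rw [zero_add]
      refine (lintegral_fourier_le_undilate ha _ (j := d) le_rfl).trans ?_
      refine (hC₄ (2 ^ d) (one_le_pow₀ (by norm_num)) _ fun x => ?_).trans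
        (ENNReal.ofReal_le_ofReal ?_)
      · rw [undilate_apply, pairing_apply_apply, ContinuousLinearMap.mul_apply']
        simp only [dyadic, dilate_apply, smul_smul, zpow_neg, zpow_natCast]
        rw [inv_mul_cancel₀ (by positivity), one_smul]
      · calc C₄ * (((2 : ℝ) ^ d) ^ M)⁻¹ = C₄ * 2 ^ M * ((1 / 2) ^ (d + 1)) ^ M := by
              rw [pow_succ, mul_pow, mul_assoc, mul_comm (_ ^ M) ((1 / 2) ^ M), ← mul_assoc (2 ^ M),
                ← mul_pow, ← inv_pow, ← inv_pow]
              norm_num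
          _ ≤ _ := by
              gcongr
              have : 0 ≤ C₁ * 2 ^ R := by positivity
              linarith
    · rw [show ν + 1 + (d + 1) = (ν + (d + 1)) + 1 by ring]
      refine (lintegral_fourier_le_undilate ha _ (j := ν + (d + 1)) le_rfl).trans ?_
      refine (hC₅ (2 ^ (d + 1)) (one_le_pow₀ (by norm_num)) _ fun x => ?_).trans
        (ENNReal.ofReal_le_ofReal ?_)
      · rw [undilate_apply, pairing_apply_apply, ContinuousLinearMap.mul_apply']
        simp only [dyadic, dilate_apply, smul_smul, zpow_neg, zpow_natCast]
        rw [inv_mul_cancel₀ (by positivity), one_smul]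
        congr 3
        rw [pow_add, ← mul_assoc, inv_mul_cancel₀ (by positivity), one_mul]
      · rw [← inv_pow, ← inv_pow, one_div]
        gcongr
        have : 0 ≤ C₄ * 2 ^ M := by positivity
        have : 0 ≤ C₁ * 2 ^ R := by positivity
        linarith

end Kernel

/-! ### Pointwise estimates of the maximal functions -/

section Peetre

variable {n : ℕ}

/-- The maximal function is a supremum of continuous functions, hence lower semicontinuous. -/
theorem measurable_peetre (Φ : ℕ → 𝓢(EuclideanSpace ℝ (Fin n), ℂ))
    (f : 𝓢'(EuclideanSpace ℝ (Fin n), ℂ)) {a : ℝ} (ha : 0 < a) (k : ℕ) :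
    Measurable (peetre Φ f a k) := by
  refine LowerSemicontinuous.measurable (lowerSemicontinuous_iSup fun y => ?_)
  refine Continuous.lowerSemicontinuous (ENNReal.continuous_ofReal.comp ?_)
  refine continuous_const.div ?_ fun x => by positivity
  exact continuous_const.add (Continuous.rpow_const (by fun_prop) fun x => .inr ha.le)

theorem enorm_conv_le_peetre (Φ : ℕ → 𝓢(EuclideanSpace ℝ (Fin n), ℂ))
    (f : 𝓢'(EuclideanSpace ℝ (Fin n), ℂ)) (a : ℝ) (k : ℕ) (x y : EuclideanSpace ℝ (Fin n)) :
    ‖conv (Φ k) f y‖ₑ ≤ peetre Φ f a k x * ENNReal.ofReal (1 + ‖(2 : ℝ) ^ k • (y - x)‖ ^ a) := by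
  have h1 : ENNReal.ofReal (‖conv (Φ k) f y‖ / (1 + ‖(2 : ℝ) ^ k • (y - x)‖ ^ a)) ≤
      peetre Φ f a k x := le_iSup (fun y => ENNReal.ofReal
    (‖conv (Φ k) f y‖ / (1 + ‖(2 : ℝ) ^ k • (y - x)‖ ^ a))) y
  refine le_trans (le_of_eq ?_) (mul_le_mul_left h1 _)
  rw [← ENNReal.ofReal_mul (by positivity), div_mul_cancel₀ _ (by positivity), ofReal_norm]

theorem one_add_norm_sub_rpow_le {V : Type*} [NormedAddCommGroup V] {a : ℝ} (ha : 0 < a) (u v : V) :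
    1 + ‖u - v‖ ^ a ≤ 2 ^ a * (1 + ‖u‖ ^ a) * (1 + ‖v‖ ^ a) := by
  have h1 : (1 : ℝ) ≤ 2 ^ a := Real.one_le_rpow (by norm_num) ha.le
  have hu : 0 ≤ ‖u‖ ^ a := by positivity
  have hv : 0 ≤ ‖v‖ ^ a := by positivity
  have h2 : ‖u - v‖ ^ a ≤ 2 ^ a * (‖u‖ ^ a + ‖v‖ ^ a) := by
    rcases le_total ‖u‖ ‖v‖ with h | h
    · calc ‖u - v‖ ^ a ≤ (2 * ‖v‖) ^ a := by
            gcongr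
            linarith [norm_sub_le u v]
        _ = 2 ^ a * ‖v‖ ^ a := Real.mul_rpow (by norm_num) (norm_nonneg v)
        _ ≤ _ := by gcongr; linarith
    · calc ‖u - v‖ ^ a ≤ (2 * ‖u‖) ^ a := by
            gcongr
            linarith [norm_sub_le u v]
        _ = 2 ^ a * ‖u‖ ^ a := Real.mul_rpow (by norm_num) (norm_nonneg u)
        _ ≤ _ := by gcongr; linarith
  have h3 : 0 ≤ 2 ^ a * (‖u‖ ^ a * ‖v‖ ^ a) := by positivity
  nlinarith

/-- Changing the dyadic scale from `k` to `ν` costs the factor `2 ^ ((k - ν) a)` only for `k > ν`. -/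
theorem one_add_norm_two_pow_smul_rpow_le {V : Type*} [NormedAddCommGroup V] [NormedSpace ℝ V]
    (a : ℝ) (ν k : ℕ) (v : V) :
    1 + ‖(2 : ℝ) ^ k • v‖ ^ a ≤
      max 1 ((2 : ℝ) ^ (((k : ℝ) - ν) * a)) * (1 + ‖(2 : ℝ) ^ ν • v‖ ^ a) := by
  have h1 : ‖(2 : ℝ) ^ k • v‖ ^ a = (2 : ℝ) ^ (((k : ℝ) - ν) * a) * ‖(2 : ℝ) ^ ν • v‖ ^ a := by
    rw [Real.rpow_mul (by norm_num), ← Real.mul_rpow (by positivity) (norm_nonneg _), norm_smul,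
      norm_smul, ← mul_assoc, Real.rpow_sub (by norm_num), Real.rpow_natCast, Real.rpow_natCast]
    simp only [norm_pow, Real.norm_two]
    rw [div_mul_cancel₀ _ (by positivity)]
  rw [h1, mul_add, mul_one]
  gcongr
  · exact le_max_left _ _
  · exact le_max_right _ _

/-- The convolution of `f` with `𝓕 (h φ_k)` is an average of `𝓕 φ_k * f`, hence at most the maximal
function at scale `k` times a weighted `L¹` norm of `𝓕 h`, with a penalty for measuring the
displacement `y - x` at scale `ν`. -/
theorem enorm_conv_pairing_le_peetre (h : 𝓢(EuclideanSpace ℝ (Fin n), ℂ))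
    (φ : ℕ → 𝓢(EuclideanSpace ℝ (Fin n), ℂ))
    (f : 𝓢'(EuclideanSpace ℝ (Fin n), ℂ)) {a : ℝ} (ha : 0 < a) (ν k : ℕ)
    (x y : EuclideanSpace ℝ (Fin n)) :
    ‖conv (𝓕 (pairing (ContinuousLinearMap.mul ℂ ℂ) h (φ k))) f y‖ₑ ≤
      ENNReal.ofReal (2 ^ a * max 1 ((2 : ℝ) ^ (((k : ℝ) - ν) * a))) *
        (∫⁻ z, ‖𝓕 h z‖ₑ * ENNReal.ofReal (1 + ‖(2 : ℝ) ^ k • z‖ ^ a)) *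
        peetre (fun j => 𝓕 (φ j)) f a k x *
        ENNReal.ofReal (1 + ‖(2 : ℝ) ^ ν • (y - x)‖ ^ a) := by
  set P := peetre (fun j => 𝓕 (φ j)) f a k x
  set L : ℝ := 2 ^ a * max 1 ((2 : ℝ) ^ (((k : ℝ) - ν) * a))
  set B : ℝ := 1 + ‖(2 : ℝ) ^ ν • (y - x)‖ ^ a
  have hmeas : Measurable fun z =>
      ‖𝓕 h z‖ₑ * ENNReal.ofReal (1 + ‖(2 : ℝ) ^ k • z‖ ^ a) := by
    exact (𝓕 h).continuous.measurable.enorm.mul (by fun_prop)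
  calc ‖conv (𝓕 (pairing (ContinuousLinearMap.mul ℂ ℂ) h (φ k))) f y‖ₑ
      ≤ ∫⁻ z, ‖𝓕 h z‖ₑ * ‖conv (𝓕 (φ k)) f (y - z)‖ₑ := enorm_conv_fourier_pairing_le h (φ k) f y
    _ ≤ ∫⁻ z, ENNReal.ofReal L * P * ENNReal.ofReal B *
          (‖𝓕 h z‖ₑ * ENNReal.ofReal (1 + ‖(2 : ℝ) ^ k • z‖ ^ a)) := by
        refine lintegral_mono fun z => ?_
        have h1 := enorm_conv_le_peetre (fun j => 𝓕 (φ j)) f a k x (y - z)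
        have h2 : 1 + ‖(2 : ℝ) ^ k • (y - z - x)‖ ^ a ≤
            L * B * (1 + ‖(2 : ℝ) ^ k • z‖ ^ a) := by
          rw [sub_right_comm, smul_sub]
          refine (one_add_norm_sub_rpow_le ha _ _).trans ?_
          have h3 := mul_le_mul_of_nonneg_left
            (one_add_norm_two_pow_smul_rpow_le a ν k (y - x)) (show (0 : ℝ) ≤ 2 ^ a by positivity)
          rw [← mul_assoc] at h3
          exact mul_le_mul_of_nonneg_right h3 (by positivity)
        calc ‖𝓕 h z‖ₑ * ‖conv (𝓕 (φ k)) f (y - z)‖ₑ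
            ≤ ‖𝓕 h z‖ₑ * (P * ENNReal.ofReal (L * B * (1 + ‖(2 : ℝ) ^ k • z‖ ^ a))) := by
              gcongr
              exact h1.trans (by gcongr)
          _ = _ := by
              rw [ENNReal.ofReal_mul (by positivity), ENNReal.ofReal_mul (by positivity)]
              ring
    _ = _ := by
        rw [lintegral_const_mul _ hmeas]
        ring

end Peetre

/-! ### Comparison of the maximal functions -/

section Comparison

variable {n : ℕ}

/-- The functional `g ↦ (𝓕 g * f)(y)` on the Schwartz space. -/
noncomputable def convFourierCLM (f : 𝓢'(EuclideanSpace ℝ (Fin n), ℂ))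
    (y : EuclideanSpace ℝ (Fin n)) : 𝓢(EuclideanSpace ℝ (Fin n), ℂ) →L[ℂ] ℂ :=
  (⟨f.toLinearMap, map_continuous f⟩ : 𝓢(EuclideanSpace ℝ (Fin n), ℂ) →L[ℂ] ℂ) ∘L
    compSubConstCLM ℂ y ∘L
    compCLMOfContinuousLinearEquiv ℂ (ContinuousLinearEquiv.neg ℝ) ∘L
    fourierCLM ℂ 𝓢(EuclideanSpace ℝ (Fin n), ℂ)

theorem convFourierCLM_apply (f : 𝓢'(EuclideanSpace ℝ (Fin n), ℂ))
    (y : EuclideanSpace ℝ (Fin n)) (g : 𝓢(EuclideanSpace ℝ (Fin n), ℂ)) :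
    convFourierCLM f y g = conv (𝓕 g) f y := rfl

/-- The reproducing formula applied to `f`. The partial sums telescope to the convolution with
`𝓕 (χ (2 ^ (-N) •) ψ)`, which tends to the convolution with `𝓕 ψ` since `χ 0 = 1`. -/
theorem enorm_conv_le_tsum {χ lam₀ lam₁ φ₀ φ₁ : 𝓢(EuclideanSpace ℝ (Fin n), ℂ)}
    (hχ : χ 0 = 1) (h₀ : ∀ x, lam₀ x * φ₀ x = χ x)
    (h₁ : ∀ x, lam₁ x * φ₁ x = χ ((2 : ℝ)⁻¹ • x) - χ x)
    (ψ : 𝓢(EuclideanSpace ℝ (Fin n), ℂ)) (f : 𝓢'(EuclideanSpace ℝ (Fin n), ℂ))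
    (y : EuclideanSpace ℝ (Fin n)) :
    ‖conv (𝓕 ψ) f y‖ₑ ≤ ∑' k, ‖conv (𝓕 (pairing (ContinuousLinearMap.mul ℂ ℂ)
      (pairing (ContinuousLinearMap.mul ℂ ℂ) ψ (dyadic lam₀ lam₁ k)) (dyadic φ₀ φ₁ k))) f y‖ₑ := by
  have hlim := ((convFourierCLM f y).continuous.tendsto ψ).comp (tendsto_pairing_dilate hχ ψ)
  rw [← convFourierCLM_apply]
  refine le_of_tendsto hlim.enorm (.of_forall fun N => ?_)
  simp only [Function.comp_apply]
  rw [← sum_pairing_dyadic h₀ h₁ ψ N, map_sum]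
  exact (enorm_sum_le _ _).trans (ENNReal.sum_le_tsum _)

theorem IsAdmissibleWeight.le_add {α α₁ α₂ : ℝ} {w : ℕ → EuclideanSpace ℝ (Fin n) → ℝ}
    (hw : IsAdmissibleWeight α α₁ α₂ w) (k d : ℕ) (x : EuclideanSpace ℝ (Fin n)) :
    w (k + d) x ≤ (2 : ℝ) ^ (α₂ * d) * w k x := by
  induction d with
  | zero => simp
  | succ d ih =>
    calc w (k + (d + 1)) x ≤ (2 : ℝ) ^ α₂ * w (k + d) x := hw.upper (k + d) x
      _ ≤ (2 : ℝ) ^ α₂ * ((2 : ℝ) ^ (α₂ * d) * w k x) := by gcongr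
      _ = _ := by
        rw [← mul_assoc, ← Real.rpow_add (by norm_num)]
        push_cast
        ring_nf

theorem IsAdmissibleWeight.le_sub {α α₁ α₂ : ℝ} {w : ℕ → EuclideanSpace ℝ (Fin n) → ℝ}
    (hw : IsAdmissibleWeight α α₁ α₂ w) (k d : ℕ) (x : EuclideanSpace ℝ (Fin n)) :
    w k x ≤ (2 : ℝ) ^ (-α₁ * d) * w (k + d) x := by
  induction d with
  | zero => simp
  | succ d ih =>
    calc w k x ≤ (2 : ℝ) ^ (-α₁ * d) * w (k + d) x := ih
      _ = (2 : ℝ) ^ (-α₁ * ((d + 1 : ℕ) : ℝ)) * ((2 : ℝ) ^ α₁ * w (k + d) x) := by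
        rw [← mul_assoc, ← Real.rpow_add (by norm_num)]
        push_cast
        ring_nf
      _ ≤ _ := by
        gcongr
        exact hw.lower (k + d) x

/-- All derivatives vanish at the origin as soon as those in the coordinate directions do. -/
theorem iteratedFDeriv_eq_zero_of_single {u : EuclideanSpace ℝ (Fin n) → ℂ} {m : ℕ}
    {x : EuclideanSpace ℝ (Fin n)} (h : ∀ i : Fin m → Fin n,
      iteratedFDeriv ℝ m u x (fun l => EuclideanSpace.single (i l) (1 : ℝ)) = 0) :
    iteratedFDeriv ℝ m u x = 0 := by
  apply ContinuousMultilinearMap.toMultilinearMap_injective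
  refine Module.Basis.ext_multilinear
    (fun _ => (EuclideanSpace.basisFun (Fin n) ℝ).toBasis) fun i => ?_
  simpa using h i

/-- The pointwise estimate behind the comparison of the maximal functions: after weighting,
`(Ψ_ν^* f)_a` is dominated by the `(Φ_k^* f)_a` with two-sided geometric decay. -/
theorem exists_peetre_mul_weight_le {α α₁ α₂ : ℝ} {w : ℕ → EuclideanSpace ℝ (Fin n) → ℝ}
    (hw : IsAdmissibleWeight α α₁ α₂ w) {a : ℝ} (ha : 0 < a) {R : ℕ}
    {ψ₀ ψ₁ φ₀ φ₁ : 𝓢(EuclideanSpace ℝ (Fin n), ℂ)}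
    (hmoment : ∀ m < R, iteratedFDeriv ℝ m ψ₁ 0 = 0) {ε : ℝ} (hε : 0 < ε)
    (h₀ : ∀ x, ‖x‖ < ε → 0 < ‖φ₀ x‖) (h₁ : ∀ x, ε / 2 < ‖x‖ → ‖x‖ < 2 * ε → 0 < ‖φ₁ x‖) :
    ∃ C : ℝ, 0 < C ∧ ∀ (f : 𝓢'(EuclideanSpace ℝ (Fin n), ℂ)) (ν : ℕ)
      (x : EuclideanSpace ℝ (Fin n)),
      peetre (fun j => 𝓕 (dyadic ψ₀ ψ₁ j)) f a ν x * ENNReal.ofReal (w ν x) ≤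
        ENNReal.ofReal C * ∑' k, geomDecay (R - α₂) ν k *
          (peetre (fun j => 𝓕 (dyadic φ₀ φ₁ j)) f a k x * ENNReal.ofReal (w k x)) := by
  obtain ⟨χ, lam₀, lam₁, hχ, hlam₀, hlam₁, r, hr, hrsupp⟩ := exists_resolution hε h₀ h₁
  -- for `k > ν` the kernel has to absorb the growth `2 ^ ((k - ν) a)` from the change of scale and
  -- `2 ^ (-α₁ (k - ν))` from the weights, and to leave the decay `2 ^ (-(R - α₂) (k - ν))`
  obtain ⟨M, hM⟩ := exists_nat_ge ((R - α₂) + a - α₁)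
  obtain ⟨C, hC0, hClow, hChigh⟩ :=
    exists_lintegral_fourier_dyadic_le ha ψ₀ ψ₁ lam₀ lam₁ hmoment hr hrsupp M
  have hwpos : ∀ j x, 0 < w j x := fun j x => by
    obtain ⟨c, -, h⟩ := hw.growth
    exact (h j x x).1
  set I : ℕ → ℕ → ℝ≥0∞ := fun ν k => ∫⁻ z, ‖𝓕 (pairing (ContinuousLinearMap.mul ℂ ℂ)
    (dyadic ψ₀ ψ₁ ν) (dyadic lam₀ lam₁ k)) z‖ₑ *
      ENNReal.ofReal (1 + ‖(2 : ℝ) ^ k • z‖ ^ a) with hI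
  set L : ℕ → ℕ → ℝ := fun ν k => 2 ^ a * max 1 ((2 : ℝ) ^ (((k : ℝ) - ν) * a)) with hL
  have hhalf : ∀ d N : ℕ, (((1 / 2 : ℝ)) ^ d) ^ N = (2 : ℝ) ^ (-(N : ℝ) * d) := fun d N => by
    rw [← pow_mul, one_div, inv_pow, ← Real.rpow_natCast, ← Real.rpow_neg (by norm_num)]
    push_cast
    ring_nf
  have hscalar : ∀ ν k x, ENNReal.ofReal (L ν k) * I ν k * ENNReal.ofReal (w ν x) ≤
      ENNReal.ofReal (2 ^ a * (C + 1)) * (geomDecay (R - α₂) ν k * ENNReal.ofReal (w k x)) := by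
    intro ν k x
    rw [geomDecay, ← ENNReal.ofReal_mul (by positivity), ← ENNReal.ofReal_mul (by positivity)]
    rcases le_or_gt k ν with hkν | hνk
    · obtain ⟨d, rfl⟩ := Nat.exists_eq_add_of_le hkν
      have hmax : max 1 ((2 : ℝ) ^ (((k : ℝ) - (k + d : ℕ)) * a)) = 1 := by
        refine max_eq_left (Real.rpow_le_one_of_one_le_of_nonpos (by norm_num) ?_)
        push_cast
        have : 0 ≤ (d : ℝ) * a := by positivity
        linarith
      calc ENNReal.ofReal (L (k + d) k) * I (k + d) k * ENNReal.ofReal (w (k + d) x)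
          ≤ ENNReal.ofReal (2 ^ a) * ENNReal.ofReal (C * ((1 / 2) ^ d) ^ R) *
              ENNReal.ofReal ((2 : ℝ) ^ (α₂ * d) * w k x) := by
            simp only [hL, hmax, mul_one]
            gcongr
            · exact hClow k d
            · exact hw.le_add k d x
        _ = ENNReal.ofReal (2 ^ a * (C * ((1 / 2) ^ d) ^ R) * ((2 : ℝ) ^ (α₂ * d) * w k x)) := by
            rw [← ENNReal.ofReal_mul (by positivity), ← ENNReal.ofReal_mul (by positivity)]
        _ ≤ _ := by
            refine ENNReal.ofReal_le_ofReal ?_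
            have habs : |(((k + d : ℕ) : ℝ)) - k| = d := by
              push_cast
              rw [add_sub_cancel_left, Nat.abs_cast]
            rw [hhalf, habs]
            have hexp : (2 : ℝ) ^ (-(R : ℝ) * d) * (2 : ℝ) ^ (α₂ * d) =
                (2 : ℝ) ^ (-(R - α₂) * d) := by
              rw [← Real.rpow_add (by norm_num)]
              ring_nf
            calc (2 : ℝ) ^ a * (C * (2 : ℝ) ^ (-(R : ℝ) * d)) * ((2 : ℝ) ^ (α₂ * d) * w k x)
                = 2 ^ a * C * ((2 : ℝ) ^ (-(R - α₂) * d) * w k x) := by rw [← hexp]; ring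
              _ ≤ _ := by
                have := hwpos k x
                gcongr
                linarith
    · obtain ⟨d, rfl⟩ := Nat.exists_eq_add_of_le (Nat.succ_le_of_lt hνk)
      rw [show ν.succ + d = ν + (d + 1) by omega]
      have hmax : max 1 ((2 : ℝ) ^ ((((ν + (d + 1) : ℕ) : ℝ) - ν) * a)) =
          (2 : ℝ) ^ (a * (d + 1 : ℕ)) := by
        rw [max_eq_right]
        · push_cast
          ring_nf
        · refine Real.one_le_rpow (by norm_num) ?_
          push_cast
          rw [add_sub_cancel_left]
          positivity
      calc ENNReal.ofReal (L ν (ν + (d + 1))) * I ν (ν + (d + 1)) * ENNReal.ofReal (w ν x)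
          ≤ ENNReal.ofReal (2 ^ a * (2 : ℝ) ^ (a * (d + 1 : ℕ))) *
              ENNReal.ofReal (C * ((1 / 2) ^ (d + 1)) ^ M) *
              ENNReal.ofReal ((2 : ℝ) ^ (-α₁ * (d + 1 : ℕ)) * w (ν + (d + 1)) x) := by
            simp only [hL, hmax]
            gcongr
            · exact hChigh ν d
            · exact hw.le_sub ν (d + 1) x
        _ = ENNReal.ofReal (2 ^ a * (2 : ℝ) ^ (a * (d + 1 : ℕ)) *
              (C * ((1 / 2) ^ (d + 1)) ^ M) *
              ((2 : ℝ) ^ (-α₁ * (d + 1 : ℕ)) * w (ν + (d + 1)) x)) := by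
            rw [← ENNReal.ofReal_mul (by positivity), ← ENNReal.ofReal_mul (by positivity)]
        _ ≤ _ := by
            refine ENNReal.ofReal_le_ofReal ?_
            have habs : |(ν : ℝ) - ((ν + (d + 1) : ℕ) : ℝ)| = (d + 1 : ℕ) := by
              rw [abs_sub_comm]
              push_cast
              rw [add_sub_cancel_left, abs_of_nonneg (by positivity)]
            rw [hhalf, habs]
            have hexp : (2 : ℝ) ^ (a * (d + 1 : ℕ)) * (2 : ℝ) ^ (-(M : ℝ) * (d + 1 : ℕ)) *
                (2 : ℝ) ^ (-α₁ * (d + 1 : ℕ)) ≤ (2 : ℝ) ^ (-(R - α₂) * (d + 1 : ℕ)) := by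
              rw [← Real.rpow_add (by norm_num), ← Real.rpow_add (by norm_num), ← add_mul,
                ← add_mul]
              gcongr
              · norm_num
              · linarith
            calc (2 : ℝ) ^ a * (2 : ℝ) ^ (a * (d + 1 : ℕ)) *
                  (C * (2 : ℝ) ^ (-(M : ℝ) * (d + 1 : ℕ))) *
                  ((2 : ℝ) ^ (-α₁ * (d + 1 : ℕ)) * w (ν + (d + 1)) x)
                = 2 ^ a * C * (((2 : ℝ) ^ (a * (d + 1 : ℕ)) *
                  (2 : ℝ) ^ (-(M : ℝ) * (d + 1 : ℕ)) * (2 : ℝ) ^ (-α₁ * (d + 1 : ℕ))) *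
                    w (ν + (d + 1)) x) := by ring
              _ ≤ _ := by
                have := hwpos (ν + (d + 1)) x
                gcongr
                linarith
  refine ⟨2 ^ a * (C + 1), by positivity, fun f ν x => ?_⟩
  set P : ℕ → ℝ≥0∞ := fun k => peetre (fun j => 𝓕 (dyadic φ₀ φ₁ j)) f a k x with hP
  have hpt : peetre (fun j => 𝓕 (dyadic ψ₀ ψ₁ j)) f a ν x ≤
      ∑' k, ENNReal.ofReal (L ν k) * I ν k * P k := by
    refine iSup_le fun y => ?_
    have hpos : 0 < 1 + ‖(2 : ℝ) ^ ν • (y - x)‖ ^ a := by positivity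
    rw [ENNReal.ofReal_div_of_pos hpos, ENNReal.div_le_iff (by simpa using hpos)
      ENNReal.ofReal_ne_top, ofReal_norm, ← ENNReal.tsum_mul_right]
    exact (enorm_conv_le_tsum hχ hlam₀ hlam₁ _ f y).trans (ENNReal.tsum_le_tsum fun k =>
      enorm_conv_pairing_le_peetre _ (dyadic φ₀ φ₁) f ha ν k x y)
  calc peetre (fun j => 𝓕 (dyadic ψ₀ ψ₁ j)) f a ν x * ENNReal.ofReal (w ν x)
      ≤ (∑' k, ENNReal.ofReal (L ν k) * I ν k * P k) * ENNReal.ofReal (w ν x) := by gcongr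
    _ = ∑' k, ENNReal.ofReal (L ν k) * I ν k * ENNReal.ofReal (w ν x) * P k := by
        rw [← ENNReal.tsum_mul_right]
        exact tsum_congr fun k => by ring
    _ ≤ ∑' k, ENNReal.ofReal (2 ^ a * (C + 1)) *
          (geomDecay (R - α₂) ν k * ENNReal.ofReal (w k x)) * P k :=
        ENNReal.tsum_le_tsum fun k => mul_le_mul' (hscalar ν k x) le_rfl
    _ = _ := by
        rw [← ENNReal.tsum_mul_left]
        exact tsum_congr fun k => by ring

end Comparison

end Microlocal

theorem theorem3p7 {n : ℕ} (α α₁ α₂ : ℝ) (w : ℕ → EuclideanSpace ℝ (Fin n) → ℝ)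
    (hw : Microlocal.IsAdmissibleWeight α α₁ α₂ w)
    (p q : EuclideanSpace ℝ (Fin n) → ℝ≥0∞)
    (hp : Microlocal.IsVariableExponent p) (hq : Microlocal.IsVariableExponent q)
    (a : ℝ) (ha : 0 < a) (R : ℕ) (hR : α₂ < R)
    (ψ₀ ψ₁ φ₀ φ₁ : 𝓢(EuclideanSpace ℝ (Fin n), ℂ))
    -- all partial derivatives of `ψ₁` of order less than `R` vanish at the origin
    (hmoment : ∀ m : ℕ, m < R → ∀ i : Fin m → Fin n,
      iteratedFDeriv ℝ m ψ₁ 0 (fun l => EuclideanSpace.single (i l) (1 : ℝ)) = 0)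
    (ε : ℝ) (hε : 0 < ε)
    (htauber₀ : ∀ x, ‖x‖ < ε → 0 < ‖φ₀ x‖)
    (htauber₁ : ∀ x, ε / 2 < ‖x‖ → ‖x‖ < 2 * ε → 0 < ‖φ₁ x‖) :
    ∃ c : ℝ, 0 < c ∧ ∀ f : 𝓢'(EuclideanSpace ℝ (Fin n), ℂ),
      Microlocal.mixedNorm p q (fun k x =>
          Microlocal.peetre (fun j => 𝓕 (Microlocal.dyadic ψ₀ ψ₁ j)) f a k x *
            ENNReal.ofReal (w k x)) ≤
        ENNReal.ofReal c * Microlocal.mixedNorm p q (fun k x =>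
          Microlocal.peetre (fun j => 𝓕 (Microlocal.dyadic φ₀ φ₁ j)) f a k x *
            ENNReal.ofReal (w k x)) := by
  obtain ⟨C, hC0, hC⟩ := Microlocal.exists_peetre_mul_weight_le hw ha
    (fun m hm => Microlocal.iteratedFDeriv_eq_zero_of_single (hmoment m hm)) hε htauber₀ htauber₁
    (ψ₀ := ψ₀)
  obtain ⟨c, hc0, hc, H⟩ := Microlocal.mixedNorm_le_of_le_tsum hp hq (sub_pos.2 hR)
    (C := ENNReal.ofReal C) (by simpa using hC0) ENNReal.ofReal_ne_top
  refine ⟨c.toReal, ENNReal.toReal_pos hc0 hc, fun f => ?_⟩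
  rw [ENNReal.ofReal_toReal hc]
  exact H _ _ (fun k => (Microlocal.measurable_peetre _ f ha k).mul
    (hw.measurable k).ennreal_ofReal) fun ν x => hC f ν x
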